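/- Let $\Gamma$ be a metric graph with finite vertex set $\mathcal V$, finite non-empty edge set $\mathcal E$ and edges of positive finite lengths $L_e$, and suppose that $\Gamma$ is a tree (connected, without cycles, loops or multiple edges). Let $V\in L_2(\Gamma)$ be real-valued. Let $\mathcal H$ be the operator acting as $-\frac{d^2}{dx^2}+V(x)$ on every edge, whose domain consists of the complex-valued functions $f$ on $\Gamma$ that belong to $H^2(e)$ on every edge $e$ and satisfy an extended $\delta$-type condition at every vertex $v$: $f$ is continuous at $v$ and $\sum_{e\ni v}\frac{df}{dx_e}(v)=\alpha_v f(v)$, where the derivatives are taken away from $v$ into the edges and $\alpha_v\in\mathbb R$ is fixed, or (the case $\alpha_v=\infty$) $f$ is continuous at $v$ and $f(v)=0$. Let $\lambda_1\le\lambda_2\le\dots$ be the eigenvalues of $\mathcal H$ in non-decreasing order, counted with multiplicity. If $\lambda_n$ is a simple eigenvalue and its eigenfunction $f^{(n)}$ is non-zero at all vertices of $\Gamma$, then $f^{(n)}$ has exactly $n-1$ zeros on $\Gamma$. -/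

import Mathlib

open MeasureTheory

/-- A metric graph with vertex set `V` and edge set `E`: every edge `e` is a segment `[0, len e]`
of positive finite length, whose coordinate runs from the vertex `src e` (at `0`) to the vertex
`tgt e` (at `len e`). Loops and multiple edges are allowed. -/
structure MetricGraph (V E : Type*) where
  src : E → V
  tgt : E → V
  len : E → ℝ
  len_pos : ∀ e, 0 < len e

/-- `w` is the second derivative of `u` on `[0, L]` in the sense of `H²(0, L)`: `u` is continuously
differentiable on `[0, L]`, `w` is square integrable, and the (at the end points one-sided)
derivative `u'` is absolutely continuous with `u'' = w`, that is `u'(x) = u'(0) + ∫₀ˣ w`.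
Thus `u` (its continuous representative) belongs to `H²(0, L)` exactly when such a `w` exists,
and `w` is then unique almost everywhere. -/
def HasSobolevSecondDeriv (L : ℝ) (u w : ℝ → ℂ) : Prop :=
  MemLp w 2 (volume.restrict (Set.Ioo 0 L)) ∧
  DifferentiableOn ℝ u (Set.Icc 0 L) ∧
  ∀ x ∈ Set.Icc 0 L,
    derivWithin u (Set.Icc 0 L) x = derivWithin u (Set.Icc 0 L) 0 + ∫ t in (0 : ℝ)..x, w t

namespace MetricGraph

variable {V E : Type*} (Γ : MetricGraph V E)

/-- The underlying simple graph: two distinct vertices are adjacent if an edge joins them. -/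
def toSimpleGraph : SimpleGraph V :=
  SimpleGraph.fromRel fun u v => ∃ e, Γ.src e = u ∧ Γ.tgt e = v

/-- A metric graph is a tree if it has no loops and no multiple edges and its underlying simple
graph is connected and has no cycles. -/
def IsTree : Prop :=
  (∀ e, Γ.src e ≠ Γ.tgt e) ∧
  Function.Injective (fun e => s(Γ.src e, Γ.tgt e)) ∧
  Γ.toSimpleGraph.IsTree

/-- The points of the metric graph: the vertices, and the interior points of the edges. -/
inductive Point {V E : Type*} (Γ : MetricGraph V E) : Type _
  | vertex (v : V) : Point Γ
  | interior (e : E) (x : ℝ) (hx : x ∈ Set.Ioo 0 (Γ.len e)) : Point Γ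

variable {Γ}

open Classical in
/-- The point at coordinate `x` on the edge `e`; the coordinate `0` gives the initial vertex of
`e` and the coordinate `len e` gives its terminal vertex. (Only `0 ≤ x ≤ len e` matters.) -/
noncomputable def onEdge (e : E) (x : ℝ) : Γ.Point :=
  if hx : x ∈ Set.Ioo 0 (Γ.len e) then Point.interior e x hx
  else if x ≤ 0 then Point.vertex (Γ.src e) else Point.vertex (Γ.tgt e)

/-- The function `f` on the metric graph along the edge `e`, in the coordinate of `e`. -/
noncomputable def along (f : Γ.Point → ℂ) (e : E) (x : ℝ) : ℂ := f (onEdge e x)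

/-- The derivative of `f` along the edge `e`, one-sided at the two ends of the edge. -/
noncomputable def edgeDeriv (f : Γ.Point → ℂ) (e : E) (x : ℝ) : ℂ :=
  derivWithin (along f e) (Set.Icc 0 (Γ.len e)) x

open Classical in
/-- The sum of the derivatives of `f` at the vertex `v` over all edge ends attached to `v`, taken
away from the vertex and into the edges. -/
noncomputable def outwardDerivSum [Fintype E] (f : Γ.Point → ℂ) (v : V) : ℂ :=
  ∑ e, ((if Γ.src e = v then edgeDeriv f e 0 else 0) +
    (if Γ.tgt e = v then -edgeDeriv f e (Γ.len e) else 0))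

/-- The extended `δ`-type condition with coefficient `a ∈ (-∞, ∞]` at the vertex `v`:
`∑ f'(v) = a f(v)` if `a` is finite, and the Dirichlet condition `f(v) = 0` if `a = ∞`.
Continuity of `f` at `v` is part of the condition too; it holds for every function on the points
of the graph which along each closed edge is continuous. -/
def DeltaCondition [Fintype E] (f : Γ.Point → ℂ) (v : V) (a : WithTop ℝ) : Prop :=
  (a = ⊤ → f (Point.vertex v) = 0) ∧
  ∀ r : ℝ, a = (r : WithTop ℝ) → outwardDerivSum f v = (r : ℂ) * f (Point.vertex v)

/-- `f` lies in the domain of the Hamiltonian `-d²/dx² + q` with extended `δ`-type conditions of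
coefficients `α` (it is `H²` on every edge and satisfies the vertex conditions),
and `-f'' + q f = μ f` almost everywhere on every edge. -/
def SolvesEigenproblem [Fintype E] (q : E → ℝ → ℝ) (α : V → WithTop ℝ) (μ : ℝ)
    (f : Γ.Point → ℂ) : Prop :=
  (∀ e, ∃ w : ℝ → ℂ, HasSobolevSecondDeriv (Γ.len e) (along f e) w ∧
    ∀ᵐ x ∂(volume.restrict (Set.Ioo 0 (Γ.len e))),
      -w x + (q e x : ℂ) * along f e x = (μ : ℂ) * along f e x) ∧
  ∀ v, DeltaCondition f v (α v)

end MetricGraph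

theorem HasSobolevSecondDeriv.intervalIntegrable {L : ℝ} {u w : ℝ → ℂ}
    (h : HasSobolevSecondDeriv L u w) {x : ℝ} (hx : x ∈ Set.Icc 0 L) :
    IntervalIntegrable w volume 0 x := by
  have h1 : IntegrableOn w (Set.Ioo 0 L) := h.1.integrable (by norm_num)
  rw [intervalIntegrable_iff_integrableOn_Ioo_of_le hx.1]
  exact h1.mono_set (Set.Ioo_subset_Ioo_right hx.2)

theorem HasSobolevSecondDeriv.add {L : ℝ} (hL : 0 < L) {u₁ w₁ u₂ w₂ : ℝ → ℂ}
    (h₁ : HasSobolevSecondDeriv L u₁ w₁) (h₂ : HasSobolevSecondDeriv L u₂ w₂) :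
    HasSobolevSecondDeriv L (u₁ + u₂) (w₁ + w₂) := by
  refine ⟨h₁.1.add h₂.1, h₁.2.1.add h₂.2.1, fun x hx => ?_⟩
  have h0 : (0 : ℝ) ∈ Set.Icc 0 L := ⟨le_rfl, hL.le⟩
  rw [derivWithin_add (h₁.2.1 x hx) (h₂.2.1 x hx), derivWithin_add (h₁.2.1 0 h0) (h₂.2.1 0 h0),
    h₁.2.2 x hx, h₂.2.2 x hx]
  simp only [Pi.add_apply]
  rw [intervalIntegral.integral_add (h₁.intervalIntegrable hx) (h₂.intervalIntegrable hx)]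
  ring

theorem HasSobolevSecondDeriv.const_smul {L : ℝ} (hL : 0 < L) (c : ℂ) {u w : ℝ → ℂ}
    (h : HasSobolevSecondDeriv L u w) : HasSobolevSecondDeriv L (c • u) (c • w) := by
  refine ⟨h.1.const_smul c, h.2.1.const_smul c, fun x hx => ?_⟩
  have h0 : (0 : ℝ) ∈ Set.Icc 0 L := ⟨le_rfl, hL.le⟩
  rw [derivWithin_const_smul c (h.2.1 x hx), derivWithin_const_smul c (h.2.1 0 h0), h.2.2 x hx]
  simp only [Pi.smul_apply]
  rw [intervalIntegral.integral_smul, smul_add]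

namespace MetricGraph

variable {V E : Type*} (Γ : MetricGraph V E)

/-- The eigenspace of the Hamiltonian `-d²/dx² + q` with extended `δ`-type conditions of
coefficients `α` for the (real) number `μ`; it is zero if `μ` is not an eigenvalue. -/
def eigenspace [Fintype E] (q : E → ℝ → ℝ) (α : V → WithTop ℝ) (μ : ℝ) :
    Submodule ℂ (Γ.Point → ℂ) where
  carrier := {f | SolvesEigenproblem q α μ f}
  zero_mem' := by
    have hz : ∀ e, along (0 : Γ.Point → ℂ) e = 0 := fun e => rfl
    refine ⟨fun e => ⟨0, ⟨MemLp.zero, ?_, ?_⟩, ?_⟩, fun v => ⟨fun _ => rfl, fun r _ => ?_⟩⟩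
    · rw [hz]; exact differentiableOn_const 0
    · intro x _; simp [hz]
    · simp [hz]
    · simp [outwardDerivSum, edgeDeriv, hz]
  add_mem' := by
    intro f g hf hg
    have hz : ∀ e, along (f + g) e = along f e + along g e := fun e => rfl
    have hd : ∀ e, ∀ x ∈ Set.Icc 0 (Γ.len e),
        edgeDeriv (f + g) e x = edgeDeriv f e x + edgeDeriv g e x := by
      intro e x hx
      obtain ⟨_, h1, _⟩ := hf.1 e
      obtain ⟨_, h2, _⟩ := hg.1 e
      rw [edgeDeriv, hz, derivWithin_add (h1.2.1 x hx) (h2.2.1 x hx)]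
      rfl
    refine ⟨fun e => ?_, fun v => ⟨fun h => ?_, fun r h => ?_⟩⟩
    · obtain ⟨w1, h1, k1⟩ := hf.1 e
      obtain ⟨w2, h2, k2⟩ := hg.1 e
      refine ⟨w1 + w2, h1.add (Γ.len_pos e) h2, ?_⟩
      filter_upwards [k1, k2] with x hx1 hx2
      rw [hz]
      simp only [Pi.add_apply]
      linear_combination hx1 + hx2
    · simp [(hf.2 v).1 h, (hg.2 v).1 h]
    · have hs : outwardDerivSum (f + g) v = outwardDerivSum f v + outwardDerivSum g v := by
        unfold outwardDerivSum
        rw [← Finset.sum_add_distrib]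
        refine Finset.sum_congr rfl fun e _ => ?_
        rw [hd e 0 ⟨le_rfl, (Γ.len_pos e).le⟩, hd e _ ⟨(Γ.len_pos e).le, le_rfl⟩]
        split_ifs <;> ring
      rw [hs, (hf.2 v).2 r h, (hg.2 v).2 r h, Pi.add_apply]
      ring
  smul_mem' := by
    intro c f hf
    have hz : ∀ e, along (c • f) e = c • along f e := fun e => rfl
    have hd : ∀ e, ∀ x ∈ Set.Icc 0 (Γ.len e), edgeDeriv (c • f) e x = c * edgeDeriv f e x := by
      intro e x hx
      obtain ⟨_, h1, _⟩ := hf.1 e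
      rw [edgeDeriv, hz, derivWithin_const_smul c (h1.2.1 x hx)]
      rfl
    refine ⟨fun e => ?_, fun v => ⟨fun h => ?_, fun r h => ?_⟩⟩
    · obtain ⟨w1, h1, k1⟩ := hf.1 e
      refine ⟨c • w1, h1.const_smul (Γ.len_pos e) c, ?_⟩
      filter_upwards [k1] with x hx1
      rw [hz]
      simp only [Pi.smul_apply, smul_eq_mul]
      linear_combination c * hx1
    · simp [(hf.2 v).1 h]
    · have hs : outwardDerivSum (c • f) v = c * outwardDerivSum f v := by
        unfold outwardDerivSum
        rw [Finset.mul_sum]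
        refine Finset.sum_congr rfl fun e _ => ?_
        rw [hd e 0 ⟨le_rfl, (Γ.len_pos e).le⟩, hd e _ ⟨(Γ.len_pos e).le, le_rfl⟩]
        split_ifs <;> ring
      rw [hs, (hf.2 v).2 r h, Pi.smul_apply, smul_eq_mul]
      ring

/-- The multiplicity of `μ` as an eigenvalue: the dimension of its eigenspace
(`0` if `μ` is not an eigenvalue). -/
noncomputable def eigenvalueMultiplicity [Fintype E] (q : E → ℝ → ℝ) (α : V → WithTop ℝ)
    (μ : ℝ) : ℕ∞ :=
  Cardinal.toENat (Module.rank ℂ (Γ.eigenspace q α μ))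

/-- The number of eigenvalues in `S`, counted with multiplicity: an eigenvalue `μ` of
multiplicity `m` contributes the `m` pairs `(μ, 0), …, (μ, m - 1)`. -/
noncomputable def eigenvalueCount [Fintype E] (q : E → ℝ → ℝ) (α : V → WithTop ℝ)
    (S : Set ℝ) : ℕ∞ :=
  {p : ℝ × ℕ | p.1 ∈ S ∧ (p.2 : ℕ∞) < Γ.eigenvalueMultiplicity q α p.1}.encard

/-- `μ` is the `n`-th eigenvalue `λ_n`, `n = 1, 2, …`, when the eigenvalues are listed in
non-decreasing order with multiplicity: fewer than `n` eigenvalues are less than `μ`, and at least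
`n` eigenvalues are less than or equal to `μ`. -/
def IsNthEigenvalue [Fintype E] (q : E → ℝ → ℝ) (α : V → WithTop ℝ) (n : ℕ) (μ : ℝ) : Prop :=
  Γ.eigenvalueCount q α (Set.Iio μ) < n ∧ (n : ℕ∞) ≤ Γ.eigenvalueCount q α (Set.Iic μ)

end MetricGraph

/-! The number of eigenvalues below `μ` equals the number of zeros of the eigenfunction; since `μ`
is simple, its index is one more. Non-vanishing at the vertices rules out Dirichlet conditions, and
simplicity makes the eigenfunction a complex multiple of a real solution `u`.

The potential is only square integrable on the edges, so with a primitive `Q` of it the equation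
becomes a linear first-order system with continuous coefficients for `u` and `p = u' - Q u`
(`sobolev_iff_isQuasiSol`). Every edge is cut into pieces so short that, for all parameters `l ≤ μ`,
no non-zero solution has two zeros on a closed piece; the cut points avoid the zeros of `u`. A
solution on a piece is then determined by its two boundary values, and the map from these to the
boundary quasi-derivatives is symmetric. Summing over the pieces and adding the vertex coefficients
gives a quadratic form on functions of the nodes, whose radical consists of the node values of real
solutions (`eigenvalueMultiplicity_eq`). The form is continuous and strictly decreasing in `l`, and
positive definite for very negative `l`. Hence the eigenvalues below `μ`, with multiplicity, are
counted by its negative index at `μ` (`encard_degenerate_eq_sigNeg`).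

At `μ` the vector `c` of node values of `u` lies in the kernel and has no zero entry. Substituting
`y * c` turns the form into a sum over pieces of `w * c_left * c_right * (y_right - y_left) ^ 2`
with `w > 0`. On a tree the increments of `y` are arbitrary, so the form is diagonalised and its
negative index is the number of pieces on which `c` changes sign (`sigNeg_form`). Such a piece
contains exactly one zero of `u`, every other piece none (`encard_zeros`). -/

/-! ### The quasi-derivative system: existence, dependence on the parameter, Wronskian. -/

/-- `(u, p)` solves on `[0, L]` the system `u' = p + Q u`, `p' = -l u - Q p - Q² u`, which is the
equation `-u'' + Q' u = l u` written in terms of `u` and the quasi-derivative `p = u' - Q u`. -/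
def IsQuasiSol (Q : ℝ → ℝ) (L l : ℝ) (u p : ℝ → ℝ) : Prop :=
  ∀ x ∈ Set.Icc 0 L,
    HasDerivWithinAt u (p x + Q x * u x) (Set.Icc 0 L) x ∧
    HasDerivWithinAt p (-l * u x - Q x * p x - Q x ^ 2 * u x) (Set.Icc 0 L) x

namespace IsQuasiSol

/-- The vector field of the quasi-derivative system. -/
def field (Q : ℝ → ℝ) (l : ℝ) (t : ℝ) (y : ℝ × ℝ) : ℝ × ℝ :=
  (y.2 + Q t * y.1, -l * y.1 - Q t * y.2 - Q t ^ 2 * y.1)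

theorem norm_field_le {Q : ℝ → ℝ} {l t K R : ℝ} (hK : |Q t| ≤ K) (hR : |l| ≤ R) (y : ℝ × ℝ) :
    ‖field Q l t y‖ ≤ (1 + R + K + K ^ 2) * ‖y‖ := by
  have h1 : |y.1| ≤ ‖y‖ := norm_fst_le y
  have h2 : |y.2| ≤ ‖y‖ := norm_snd_le y
  have hn := norm_nonneg y
  have hK0 : 0 ≤ K := (abs_nonneg _).trans hK
  have hR0 : 0 ≤ R := (abs_nonneg _).trans hR
  have e1 : |Q t * y.1| ≤ K * ‖y‖ := by rw [abs_mul]; gcongr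
  have e2 : |l * y.1| ≤ R * ‖y‖ := by rw [abs_mul]; gcongr
  have e3 : |Q t * y.2| ≤ K * ‖y‖ := by rw [abs_mul]; gcongr
  have e4 : |Q t ^ 2 * y.1| ≤ K ^ 2 * ‖y‖ := by rw [abs_mul, abs_pow]; gcongr
  have p1 : 0 ≤ R * ‖y‖ := by positivity
  have p2 : 0 ≤ K * ‖y‖ := by positivity
  have p3 : 0 ≤ K ^ 2 * ‖y‖ := by positivity
  rw [abs_le] at h1 h2 e1 e2 e3 e4
  refine norm_prod_le_iff.2 ⟨?_, ?_⟩ <;> rw [Real.norm_eq_abs, abs_le] <;> simp only [field] <;>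
    constructor <;> linarith [h1.1, h1.2, h2.1, h2.2, e1.1, e1.2, e2.1, e2.2, e3.1, e3.2, e4.1, e4.2]

theorem field_sub (Q : ℝ → ℝ) (l t : ℝ) (y z : ℝ × ℝ) :
    field Q l t y - field Q l t z = field Q l t (y - z) := by
  ext <;> simp [field] <;> ring

theorem lipschitzWith_field {Q : ℝ → ℝ} {l t K R : ℝ} (hK : |Q t| ≤ K) (hR : |l| ≤ R) :
    LipschitzWith (1 + R + K + K ^ 2).toNNReal (field Q l t) := by
  refine LipschitzWith.of_dist_le_mul fun y z => ?_
  have hK0 : 0 ≤ K := (abs_nonneg _).trans hK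
  have hR0 : 0 ≤ R := (abs_nonneg _).trans hR
  rw [dist_eq_norm, dist_eq_norm, field_sub, Real.coe_toNNReal _ (by positivity)]
  exact norm_field_le hK hR _

/-- Truncation of both coordinates to `[-R, R]`. -/
def clamp (R : ℝ) (y : ℝ × ℝ) : ℝ × ℝ := (max (-R) (min R y.1), max (-R) (min R y.2))

theorem clamp_eq_self {R : ℝ} {y : ℝ × ℝ} (h : ‖y‖ ≤ R) : clamp R y = y := by
  have h1 : |y.1| ≤ R := (norm_fst_le y).trans h
  have h2 : |y.2| ≤ R := (norm_snd_le y).trans h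
  rw [abs_le] at h1 h2
  simp [clamp, h1, h2]

theorem norm_clamp_le {R : ℝ} (hR : 0 ≤ R) (y : ℝ × ℝ) : ‖clamp R y‖ ≤ R := by
  refine norm_prod_le_iff.2 ⟨?_, ?_⟩ <;> rw [Real.norm_eq_abs, abs_le] <;> simp [clamp] <;> grind

theorem norm_clamp_le_norm {R : ℝ} (hR : 0 ≤ R) (y : ℝ × ℝ) : ‖clamp R y‖ ≤ ‖y‖ := by
  have h1 : |y.1| ≤ ‖y‖ := norm_fst_le y
  have h2 : |y.2| ≤ ‖y‖ := norm_snd_le y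
  have hn := norm_nonneg y
  rw [abs_le] at h1 h2
  refine norm_prod_le_iff.2 ⟨?_, ?_⟩ <;> rw [Real.norm_eq_abs, abs_le] <;> simp only [clamp] <;> grind

theorem lipschitzWith_clamp (R : ℝ) : LipschitzWith 1 (clamp R) := by
  have h : LipschitzWith 1 fun x : ℝ => max (-R) (min R x) :=
    (LipschitzWith.id.const_min R).const_max (-R)
  have := (h.comp LipschitzWith.prod_fst).prodMk (h.comp LipschitzWith.prod_snd)
  rwa [mul_one, max_self] at this

theorem _root_.HasDerivWithinAt.Ici_of_Icc {F : Type*} [NormedAddCommGroup F] [NormedSpace ℝ F]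
    {f : ℝ → F} {f' : F} {a b t : ℝ} (h : HasDerivWithinAt f f' (Set.Icc a b) t)
    (ht : t ∈ Set.Ico a b) : HasDerivWithinAt f f' (Set.Ici t) t :=
  h.mono_of_mem_nhdsWithin (Filter.mem_of_superset (Icc_mem_nhdsGE ht.2)
    (Set.Icc_subset_Icc_left ht.1))

theorem iff_field {Q : ℝ → ℝ} {L l : ℝ} {u p : ℝ → ℝ} :
    IsQuasiSol Q L l u p ↔ ∀ x ∈ Set.Icc 0 L,
      HasDerivWithinAt (fun x => (u x, p x)) (field Q l x (u x, p x)) (Set.Icc 0 L) x :=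
  ⟨fun h x hx => (h x hx).1.prodMk (h x hx).2, fun h x hx =>
    ⟨((ContinuousLinearMap.fst ℝ ℝ ℝ).hasFDerivAt.comp_hasDerivWithinAt x (h x hx)),
      ((ContinuousLinearMap.snd ℝ ℝ ℝ).hasFDerivAt.comp_hasDerivWithinAt x (h x hx))⟩⟩

/-- The field is only globally Lipschitz, not bounded, so Picard–Lindelöf is applied to the field
truncated at radius `R`. Grönwall's bound shows that the solution never leaves this radius, where
the truncation does nothing. -/
theorem exists_sol {Q : ℝ → ℝ} (hQ : Continuous Q) {L : ℝ} (hL : 0 < L) (l a b : ℝ) :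
    ∃ u p, IsQuasiSol Q L l u p ∧ u 0 = a ∧ p 0 = b := by
  obtain ⟨K, hK⟩ := (isCompact_Icc (a := (0 : ℝ)) (b := L)).exists_bound_of_continuousOn
    hQ.continuousOn
  simp only [Real.norm_eq_abs] at hK
  have hK0 : 0 ≤ K := (abs_nonneg _).trans (hK 0 ⟨le_rfl, hL.le⟩)
  set M : ℝ := 1 + |l| + K + K ^ 2 with hM
  have hM0 : 0 ≤ M := by positivity
  set y₀ : ℝ × ℝ := (a, b)
  set R : ℝ := ‖y₀‖ * Real.exp (M * L)
  have hR : 0 ≤ R := by positivity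
  have hfield : ∀ t ∈ Set.Icc 0 L, ∀ y, ‖field Q l t y‖ ≤ M * ‖y‖ := fun t ht y =>
    norm_field_le (hK t ht) le_rfl y
  -- The truncated field has norm at most `M * R`, so over a time `L` a trajectory moves at most `M
  -- * R * L`: one application covers the whole interval.
  have hpl : IsPicardLindelof (fun t y => field Q l t (clamp R y)) (tmin := 0) (tmax := L)
      ⟨0, le_rfl, hL.le⟩ y₀ (M * R * L).toNNReal 0 (M * R).toNNReal M.toNNReal := by
    refine ⟨fun t ht => ?_, fun y _ => ?_, fun t ht y _ => ?_, ?_⟩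
    · have := (lipschitzWith_field (hK t ht) (le_refl |l|)).comp (lipschitzWith_clamp R)
      rw [mul_one] at this
      exact this.lipschitzOnWith
    · unfold field; fun_prop
    · rw [Real.coe_toNNReal _ (by positivity)]
      exact (hfield t ht _).trans (mul_le_mul_of_nonneg_left (norm_clamp_le hR y) hM0)
    · rw [Real.coe_toNNReal _ (by positivity), Real.coe_toNNReal _ (by positivity)]
      simp [hL.le]
  obtain ⟨y, hy0, hy⟩ := hpl.exists_eq_forall_mem_Icc_hasDerivWithinAt₀
  simp only at hy0
  have hbound : ∀ t ∈ Set.Icc 0 L, ‖y t‖ ≤ R := by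
    intro t ht
    have := norm_le_gronwallBound_of_norm_deriv_right_le (f := y)
      (f' := fun t => field Q l t (clamp R (y t))) (δ := ‖y₀‖) (K := M) (ε := 0) (a := 0) (b := L)
      (fun t ht => (hy t ht).continuousWithinAt)
      (fun t ht => (hy t ⟨ht.1, ht.2.le⟩).Ici_of_Icc ht) (by rw [hy0])
      (fun t ht => by
        rw [add_zero]
        exact (hfield t ⟨ht.1, ht.2.le⟩ _).trans
          (mul_le_mul_of_nonneg_left (norm_clamp_le_norm hR _) hM0)) t ht
    rw [gronwallBound_ε0, sub_zero] at this
    refine this.trans ?_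
    have := ht.2
    simp only [R]
    gcongr
  refine ⟨fun t => (y t).1, fun t => (y t).2, iff_field.2 fun t ht => ?_, by simp [hy0, y₀],
    by simp [hy0, y₀]⟩
  have := hy t ht
  rwa [clamp_eq_self (hbound t ht)] at this

theorem continuousOn_left {Q : ℝ → ℝ} {L l : ℝ} {u p : ℝ → ℝ} (h : IsQuasiSol Q L l u p) :
    ContinuousOn u (Set.Icc 0 L) := fun x hx => (h x hx).1.continuousWithinAt

theorem continuousOn_right {Q : ℝ → ℝ} {L l : ℝ} {u p : ℝ → ℝ} (h : IsQuasiSol Q L l u p) :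
    ContinuousOn p (Set.Icc 0 L) := fun x hx => (h x hx).2.continuousWithinAt

/-- Solutions with fixed initial values depend continuously on the spectral parameter. -/
theorem continuous_param {Q : ℝ → ℝ} (hQ : Continuous Q) {L : ℝ} {u p : ℝ → ℝ → ℝ}
    (h : ∀ l, IsQuasiSol Q L l (u l) (p l)) {a b : ℝ} (hu : ∀ l, u l 0 = a) (hp : ∀ l, p l 0 = b)
    {x : ℝ} (hx : x ∈ Set.Icc 0 L) : Continuous (fun l => (u l x, p l x)) := by
  have hL : 0 ≤ L := hx.1.trans hx.2
  obtain ⟨K, hK⟩ := (isCompact_Icc (a := (0 : ℝ)) (b := L)).exists_bound_of_continuousOn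
    hQ.continuousOn
  simp only [Real.norm_eq_abs] at hK
  have hK0 : 0 ≤ K := (abs_nonneg _).trans (hK 0 ⟨le_rfl, hL⟩)
  rw [continuous_iff_continuousAt]
  intro l₀
  obtain ⟨B, hB⟩ := (isCompact_Icc (a := (0 : ℝ)) (b := L)).exists_bound_of_continuousOn
    (h l₀).continuousOn_left
  set M : ℝ := 1 + (|l₀| + 1) + K + K ^ 2
  have hM0 : 0 < M := by positivity
  -- The trajectory for `l₀` solves the system for `l` with defect at most `|l - l₀| * B`. The
  -- constant `M` is a Lipschitz constant valid for all `l` within distance 1 of `l₀`, so Grönwall's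
  -- estimate is uniform there.
  have key : ∀ l, |l - l₀| ≤ 1 → dist (u l x, p l x) (u l₀ x, p l₀ x) ≤
      |l - l₀| * B / M * (Real.exp (M * (x - 0)) - 1) := by
    intro l hl
    have hl' : |l| ≤ |l₀| + 1 := by
      calc |l| = |l₀ + (l - l₀)| := by ring_nf
        _ ≤ _ := (abs_add_le _ _).trans (by linarith)
    have := dist_le_of_approx_trajectories_ODE_of_mem (v := field Q l) (s := fun _ => Set.univ)
      (K := M.toNNReal) (a := 0) (b := L) (εf := 0) (εg := |l - l₀| * B) (δ := 0)
      (f := fun t => (u l t, p l t)) (g := fun t => (u l₀ t, p l₀ t))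
      (fun t ht => (lipschitzWith_field (hK t ⟨ht.1, ht.2.le⟩) hl').lipschitzOnWith)
      (fun t ht => (iff_field.1 (h l) t ht).continuousWithinAt)
      (fun t ht => (iff_field.1 (h l) t ⟨ht.1, ht.2.le⟩).Ici_of_Icc ht)
      (fun t ht => by simp) (fun _ _ => trivial)
      (fun t ht => (iff_field.1 (h l₀) t ht).continuousWithinAt)
      (fun t ht => (iff_field.1 (h l₀) t ⟨ht.1, ht.2.le⟩).Ici_of_Icc ht)
      (fun t ht => by
        have e : field Q l₀ t (u l₀ t, p l₀ t) - field Q l t (u l₀ t, p l₀ t) =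
            (0, (l - l₀) * u l₀ t) := by
          ext <;> simp [field]; ring
        rw [dist_eq_norm, e]
        have := hB t ⟨ht.1, ht.2.le⟩
        rw [Real.norm_eq_abs] at this
        simp only [Prod.norm_mk, norm_zero, norm_mul, Real.norm_eq_abs]
        exact max_le (by positivity [(abs_nonneg _).trans this]) (by gcongr)) (fun _ _ => trivial)
      (by simp [hu, hp]) x hx
    rw [gronwallBound_of_K_ne_0 (by simpa using hM0), Real.coe_toNNReal _ hM0.le] at this
    simpa using this
  rw [ContinuousAt, tendsto_iff_dist_tendsto_zero]
  have hlim : Filter.Tendsto (fun l => |l - l₀| * B / M * (Real.exp (M * (x - 0)) - 1))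
      (nhds l₀) (nhds 0) := by
    have : Continuous (fun l => |l - l₀| * B / M * (Real.exp (M * (x - 0)) - 1)) := by fun_prop
    simpa using this.tendsto l₀
  refine squeeze_zero' (Filter.Eventually.of_forall fun _ => dist_nonneg) ?_ hlim
  filter_upwards [Metric.closedBall_mem_nhds l₀ one_pos] with l hl
  exact key l (by simpa [Real.dist_eq] using hl)

/-- The Wronskian of two solutions for the same parameter is constant. -/
theorem wronskian {Q : ℝ → ℝ} {L l : ℝ} {u p v r : ℝ → ℝ} (hu : IsQuasiSol Q L l u p)
    (hv : IsQuasiSol Q L l v r) {x : ℝ} (hx : x ∈ Set.Icc 0 L) :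
    u x * r x - v x * p x = u 0 * r 0 - v 0 * p 0 := by
  have hd : ∀ y ∈ Set.Icc 0 L,
      HasDerivWithinAt (fun y => u y * r y - v y * p y) 0 (Set.Icc 0 L) y := by
    intro y hy
    refine (((hu y hy).1.mul (hv y hy).2).sub ((hv y hy).1.mul (hu y hy).2)).congr_deriv ?_
    ring
  refine constant_of_derivWithin_zero (fun y hy => (hd y hy).differentiableWithinAt)
    (fun y hy => ?_) x hx
  exact (hd y ⟨hy.1, hy.2.le⟩).derivWithin
    (uniqueDiffOn_Icc (hy.1.trans_lt hy.2) y ⟨hy.1, hy.2.le⟩)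

theorem comb {Q : ℝ → ℝ} {L l : ℝ} {u p v r : ℝ → ℝ} (hu : IsQuasiSol Q L l u p)
    (hv : IsQuasiSol Q L l v r) (A B : ℝ) :
    IsQuasiSol Q L l (fun x => A * u x + B * v x) (fun x => A * p x + B * r x) := fun x hx =>
  ⟨(((hu x hx).1.const_mul A).add ((hv x hx).1.const_mul B)).congr_deriv (by ring),
    (((hu x hx).2.const_mul A).add ((hv x hx).2.const_mul B)).congr_deriv (by ring)⟩

end IsQuasiSol

/-- A fundamental system of solutions of the quasi-derivative system on `[0, L]`, normalised at
`0`, for every value of the spectral parameter. -/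
structure FundSystem (Q : ℝ → ℝ) (L : ℝ) where
  θ : ℝ → ℝ → ℝ
  θ' : ℝ → ℝ → ℝ
  φ : ℝ → ℝ → ℝ
  φ' : ℝ → ℝ → ℝ
  solθ : ∀ l, IsQuasiSol Q L l (θ l) (θ' l)
  solφ : ∀ l, IsQuasiSol Q L l (φ l) (φ' l)
  θ_zero : ∀ l, θ l 0 = 1
  θ'_zero : ∀ l, θ' l 0 = 0
  φ_zero : ∀ l, φ l 0 = 0
  φ'_zero : ∀ l, φ' l 0 = 1

namespace FundSystem

theorem nonempty {Q : ℝ → ℝ} (hQ : Continuous Q) {L : ℝ} (hL : 0 < L) :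
    Nonempty (FundSystem Q L) := by
  choose θ θ' h1 h2 h3 using fun l => IsQuasiSol.exists_sol hQ hL l 1 0
  choose φ φ' k1 k2 k3 using fun l => IsQuasiSol.exists_sol hQ hL l 0 1
  exact ⟨⟨θ, θ', φ, φ', h1, k1, h2, h3, k2, k3⟩⟩

variable {Q : ℝ → ℝ} {L : ℝ} (F : FundSystem Q L)

theorem wronskian (l : ℝ) {x : ℝ} (hx : x ∈ Set.Icc 0 L) :
    F.θ l x * F.φ' l x - F.φ l x * F.θ' l x = 1 := by
  rw [(F.solθ l).wronskian (F.solφ l) hx]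
  simp [F.θ_zero, F.θ'_zero, F.φ_zero, F.φ'_zero]

/-- Every solution is a combination of the fundamental ones. -/
theorem eq_comb {l : ℝ} {u p : ℝ → ℝ} (h : IsQuasiSol Q L l u p) {x : ℝ} (hx : x ∈ Set.Icc 0 L) :
    u x = u 0 * F.θ l x + p 0 * F.φ l x ∧ p x = u 0 * F.θ' l x + p 0 * F.φ' l x := by
  have w := F.wronskian l hx
  have w1 := h.wronskian (F.solθ l) hx
  have w2 := h.wronskian (F.solφ l) hx
  rw [F.θ_zero, F.θ'_zero] at w1
  rw [F.φ_zero, F.φ'_zero] at w2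
  constructor
  · linear_combination (-u x) * w - F.φ l x * w1 + F.θ l x * w2
  · linear_combination (-p x) * w - F.φ' l x * w1 + F.θ' l x * w2

theorem continuous_θ (hQ : Continuous Q) {x : ℝ} (hx : x ∈ Set.Icc 0 L) :
    Continuous (fun l => F.θ l x) :=
  (IsQuasiSol.continuous_param hQ F.solθ F.θ_zero F.θ'_zero hx).fst

theorem continuous_θ' (hQ : Continuous Q) {x : ℝ} (hx : x ∈ Set.Icc 0 L) :
    Continuous (fun l => F.θ' l x) :=
  (IsQuasiSol.continuous_param hQ F.solθ F.θ_zero F.θ'_zero hx).snd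

theorem continuous_φ (hQ : Continuous Q) {x : ℝ} (hx : x ∈ Set.Icc 0 L) :
    Continuous (fun l => F.φ l x) :=
  (IsQuasiSol.continuous_param hQ F.solφ F.φ_zero F.φ'_zero hx).fst

theorem continuous_φ' (hQ : Continuous Q) {x : ℝ} (hx : x ∈ Set.Icc 0 L) :
    Continuous (fun l => F.φ' l x) :=
  (IsQuasiSol.continuous_param hQ F.solφ F.φ_zero F.φ'_zero hx).snd

end FundSystem

/-! ### Riccati inequalities and monotone energies. -/

/-- A monotone function with no net increase is constant. The equality case is what later makes the
inequalities between forms strict. -/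
theorem le_and_deriv_eq_zero_of_deriv_nonneg {g g' : ℝ → ℝ} {a b : ℝ} (hab : a ≤ b)
    (hg : ∀ x ∈ Set.Icc a b, HasDerivWithinAt g (g' x) (Set.Icc a b) x)
    (h0 : ∀ x ∈ Set.Icc a b, 0 ≤ g' x) :
    g a ≤ g b ∧ (g b ≤ g a → ∀ x ∈ Set.Ioo a b, g' x = 0) := by
  have hd : ∀ x ∈ Set.Ioo a b, HasDerivAt g (g' x) x := fun x hx =>
    (hg x (Set.Ioo_subset_Icc_self hx)).hasDerivAt (Icc_mem_nhds hx.1 hx.2)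
  have hm : MonotoneOn g (Set.Icc a b) := by
    refine monotoneOn_of_deriv_nonneg (convex_Icc a b) (fun x hx => (hg x hx).continuousWithinAt)
      ?_ ?_ <;> rw [interior_Icc]
    · exact fun x hx => (hd x hx).differentiableAt.differentiableWithinAt
    · exact fun x hx => (hd x hx).deriv ▸ h0 x (Set.Ioo_subset_Icc_self hx)
  refine ⟨hm ⟨le_rfl, hab⟩ ⟨hab, le_rfl⟩ hab, fun hba x hx => ?_⟩
  have hc : g =ᶠ[nhds x] fun _ => g a := by
    filter_upwards [Icc_mem_nhds hx.1 hx.2] with y hy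
    exact le_antisymm ((hm hy ⟨hab, le_rfl⟩ hy.2).trans hba) (hm ⟨le_rfl, hab⟩ hy hy.1)
  exact (hd x hx).unique ((hasDerivAt_const x (g a)).congr_of_eventuallyEq hc)

theorem eq_zero_on_Icc_of_Ioo {u : ℝ → ℝ} {a b : ℝ} (hab : a < b) (hu : ContinuousOn u (Set.Icc a b))
    (h : ∀ x ∈ Set.Ioo a b, u x = 0) : ∀ x ∈ Set.Icc a b, u x = 0 := by
  have := (show Set.EqOn u (fun _ => 0) (Set.Ioo a b) from h).of_subset_closure hu
    continuousOn_const Set.Ioo_subset_Icc_self (closure_Ioo hab.ne).ge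
  exact this

/-- The affine function `r x = c + D x` is a strict subsolution on `[a, b]` of the Riccati equation
`r' = r² - 2 Q r + l + Q²` of the quasi-derivative system. -/
def RiccatiOn (Q : ℝ → ℝ) (l c D a b : ℝ) : Prop :=
  ∀ x ∈ Set.Icc a b, (c + D * x) ^ 2 - 2 * (c + D * x) * Q x + l + Q x ^ 2 < D

namespace RiccatiOn

variable {Q : ℝ → ℝ} {l l' c D a b : ℝ}

theorem mono_param (h : RiccatiOn Q l' c D a b) (hl : l ≤ l') : RiccatiOn Q l c D a b :=
  fun x hx => by linarith [h x hx]

theorem mono_set {a' b' : ℝ} (h : RiccatiOn Q l c D a b) (ha : a ≤ a') (hb : b' ≤ b) :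
    RiccatiOn Q l c D a' b' := fun x hx => h x ⟨ha.trans hx.1, hx.2.trans hb⟩

/-- The function `r x = D * (x - a)` stays in `[0, 1]` on an interval of length at most `1 / D`, so
the left side of the inequality is bounded independently of the interval, and `D` is chosen larger
than this bound. -/
theorem exists_of_short (hQ : Continuous Q) (L μ : ℝ) : ∃ ℓ > 0, ∀ a b, 0 ≤ a → b ≤ L →
    b - a ≤ ℓ → ∃ c D, RiccatiOn Q μ c D a b := by
  obtain ⟨K, hK⟩ := (isCompact_Icc (a := (0 : ℝ)) (b := L)).exists_bound_of_continuousOn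
    hQ.continuousOn
  set D : ℝ := |μ| + K ^ 2 + 2 * |K| + 2
  have hD : 0 < D := by positivity
  refine ⟨1 / D, by positivity, fun a b ha hb hab => ⟨-(D * a), D, fun x hx => ?_⟩⟩
  have hq := hK x ⟨ha.trans hx.1, hx.2.trans hb⟩
  rw [Real.norm_eq_abs] at hq
  have hq2 : Q x ^ 2 ≤ K ^ 2 := sq_le_sq' (by linarith [neg_abs_le (Q x)]) (le_of_abs_le hq)
  set y := -(D * a) + D * x
  have hy0 : 0 ≤ y := by
    have := mul_le_mul_of_nonneg_left hx.1 hD.le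
    simp only [y]; linarith
  have hy1 : y ≤ 1 := by
    have h1 : D * (x - a) ≤ D * (1 / D) := by
      apply mul_le_mul_of_nonneg_left _ hD.le
      linarith [hx.2]
    rw [mul_one_div_cancel hD.ne'] at h1
    simp only [y]; linarith
  have e1 : -(2 * y * Q x) ≤ 2 * |K| := by
    have h2 : |y * Q x| ≤ 1 * |K| := by
      rw [abs_mul]
      refine mul_le_mul ?_ (hq.trans (le_abs_self K)) (abs_nonneg _) zero_le_one
      rwa [abs_of_nonneg hy0]
    linarith [neg_abs_le (y * Q x)]
  have e2 : y ^ 2 ≤ 1 := by nlinarith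
  simp only [D]
  linarith [le_abs_self μ]

/-- Complementary to short intervals: any affine function works on the whole edge once the parameter
is low enough. The freedom in `c` and `D` is used to dominate the vertex terms. -/
theorem exists_low (hQ : Continuous Q) {L : ℝ} (c D : ℝ) : ∃ l, RiccatiOn Q l c D 0 L := by
  obtain ⟨K, hK⟩ := (isCompact_Icc (a := (0 : ℝ)) (b := L)).exists_bound_of_continuousOn
    (f := fun x => D - ((c + D * x) ^ 2 - 2 * (c + D * x) * Q x + Q x ^ 2)) (by fun_prop)
  refine ⟨-K - 1, fun x hx => ?_⟩
  have := neg_abs_le (D - ((c + D * x) ^ 2 - 2 * (c + D * x) * Q x + Q x ^ 2))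
  have h2 := hK x hx
  rw [Real.norm_eq_abs] at h2
  linarith

end RiccatiOn

namespace IsQuasiSol

variable {Q : ℝ → ℝ} {L l l' c D a b : ℝ} {u p v r : ℝ → ℝ}

/-- The monotone quantity `u p + (c + D x) u²` of a solution. -/
theorem energy (h : IsQuasiSol Q L l u p) (ha : 0 ≤ a) (hab : a < b) (hb : b ≤ L)
    (hr : RiccatiOn Q l c D a b) :
    u a * p a + (c + D * a) * u a ^ 2 ≤ u b * p b + (c + D * b) * u b ^ 2 ∧
    (u b * p b + (c + D * b) * u b ^ 2 ≤ u a * p a + (c + D * a) * u a ^ 2 →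
      ∀ x ∈ Set.Icc a b, u x = 0) := by
  have hsub : Set.Icc a b ⊆ Set.Icc 0 L := Set.Icc_subset_Icc ha hb
  -- With `r = c + D x`, completing the square writes the derivative as `(p + r u) ^ 2` plus `u ^ 2`
  -- times the gap in the Riccati inequality.
  have key := le_and_deriv_eq_zero_of_deriv_nonneg (g := fun x => u x * p x + (c + D * x) * u x ^ 2)
    (g' := fun x => (p x + (c + D * x) * u x) ^ 2 +
      (D - ((c + D * x) ^ 2 - 2 * (c + D * x) * Q x + l + Q x ^ 2)) * u x ^ 2) hab.le
    (fun x hx => by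
      have h1 := (h x (hsub hx)).1.mono hsub
      have h2 := (h x (hsub hx)).2.mono hsub
      have h3 : HasDerivWithinAt (fun x => c + D * x) D (Set.Icc a b) x := by
        simpa using ((hasDerivWithinAt_id x (Set.Icc a b)).const_mul D).const_add c
      refine ((h1.mul h2).add (h3.mul (h1.pow 2))).congr_deriv ?_
      simp only [Pi.pow_apply]
      push_cast
      ring)
    (fun x hx => by
      have := hr x hx
      have : 0 ≤ D - ((c + D * x) ^ 2 - 2 * (c + D * x) * Q x + l + Q x ^ 2) := by linarith
      positivity)
  refine ⟨key.1, fun hle => eq_zero_on_Icc_of_Ioo hab (h.continuousOn_left.mono hsub)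
    fun x hx => ?_⟩
  have h1 := key.2 hle x hx
  have h2 := hr x (Set.Ioo_subset_Icc_self hx)
  have h3 : 0 < D - ((c + D * x) ^ 2 - 2 * (c + D * x) * Q x + l + Q x ^ 2) := by linarith
  by_contra hne
  have : 0 < u x ^ 2 := by positivity
  nlinarith [mul_pos h3 this, sq_nonneg (p x + (c + D * x) * u x)]

/-- Comparison of two solutions with the same boundary values and different parameters. -/
theorem comparison (hu : IsQuasiSol Q L l u p) (hv : IsQuasiSol Q L l' v r) (hl : l < l')
    (ha : 0 ≤ a) (hab : a < b) (hb : b ≤ L) (hr : RiccatiOn Q l' c D a b)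
    (hua : u a = v a) (hub : u b = v b) :
    v b * r b - v a * r a ≤ u b * p b - u a * p a ∧
    (u b * p b - u a * p a ≤ v b * r b - v a * r a → ∀ x ∈ Set.Icc a b, u x = 0) := by
  have hsub : Set.Icc a b ⊆ Set.Icc 0 L := Set.Icc_subset_Icc ha hb
  -- A Picone-type identity. The last two terms of `g` vanish at both ends because the boundary
  -- values agree. In effect `v` minimises the energy for `l'` among functions with its boundary
  -- values, and passing from `l'` to `l` adds `(l' - l) * u ^ 2`.
  have key := le_and_deriv_eq_zero_of_deriv_nonneg
    (g := fun x => u x * p x - v x * r x - 2 * ((u x - v x) * r x) +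
      (c + D * x) * (u x - v x) ^ 2)
    (g' := fun x => (l' - l) * u x ^ 2 + ((p x - r x) + (c + D * x) * (u x - v x)) ^ 2 +
      (D - ((c + D * x) ^ 2 - 2 * (c + D * x) * Q x + l' + Q x ^ 2)) * (u x - v x) ^ 2) hab.le
    (fun x hx => by
      have h1 := (hu x (hsub hx)).1.mono hsub
      have h2 := (hu x (hsub hx)).2.mono hsub
      have k1 := (hv x (hsub hx)).1.mono hsub
      have k2 := (hv x (hsub hx)).2.mono hsub
      have h3 : HasDerivWithinAt (fun x => c + D * x) D (Set.Icc a b) x := by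
        simpa using ((hasDerivWithinAt_id x (Set.Icc a b)).const_mul D).const_add c
      refine ((((h1.mul h2).sub (k1.mul k2)).sub (((h1.sub k1).mul k2).const_mul 2)).add
        (h3.mul ((h1.sub k1).pow 2))).congr_deriv ?_
      simp only [Pi.pow_apply, Pi.sub_apply]
      push_cast
      ring)
    (fun x hx => by
      have := hr x hx
      have : 0 ≤ D - ((c + D * x) ^ 2 - 2 * (c + D * x) * Q x + l' + Q x ^ 2) := by linarith
      have : 0 ≤ l' - l := by linarith
      positivity)
  simp only [hua, hub, sub_self] at key
  rw [hua, hub]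
  refine ⟨by linarith [key.1], fun hle => eq_zero_on_Icc_of_Ioo hab
    (hu.continuousOn_left.mono hsub) fun x hx => ?_⟩
  have h1 := key.2 (by linarith) x hx
  have h2 := hr x (Set.Ioo_subset_Icc_self hx)
  have h3 : 0 ≤ D - ((c + D * x) ^ 2 - 2 * (c + D * x) * Q x + l' + Q x ^ 2) := by linarith
  by_contra hne
  have : 0 < u x ^ 2 := by positivity
  nlinarith [mul_pos (sub_pos.2 hl) this, sq_nonneg ((p x - r x) + (c + D * x) * (u x - v x)),
    mul_nonneg h3 (sq_nonneg (u x - v x))]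

end IsQuasiSol

/-! ### The boundary form of an interval without conjugate points. -/

namespace FundSystem

variable {Q : ℝ → ℝ} {L : ℝ} (F : FundSystem Q L) {l l' c D a b : ℝ} {u p : ℝ → ℝ}

/-- `y ↦ F.s l x y` is the solution which vanishes at `x` with derivative `1`. -/
def s (l x y : ℝ) : ℝ := F.θ l x * F.φ l y - F.φ l x * F.θ l y

/-- Diagonal coefficient of the boundary form of `[a, b]` at `a`. -/
noncomputable def diagLeft (l a b : ℝ) : ℝ := (F.θ l b * F.φ' l a - F.φ l b * F.θ' l a) / F.s l a b

/-- Diagonal coefficient of the boundary form of `[a, b]` at `b`. -/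
noncomputable def diagRight (l a b : ℝ) : ℝ := (F.θ l a * F.φ' l b - F.φ l a * F.θ' l b) / F.s l a b

theorem sol_eq_comb (h : IsQuasiSol Q L l u p) {x y : ℝ} (hx : x ∈ Set.Icc 0 L)
    (hy : y ∈ Set.Icc 0 L) :
    u y = u x * (F.θ l y * F.φ' l x - F.φ l y * F.θ' l x) + p x * F.s l x y := by
  have w := F.wronskian l hx
  have h1 := F.eq_comb h hx
  have h2 := F.eq_comb h hy
  rw [h1.1, h1.2, h2.1, s]
  linear_combination (-(u 0 * F.θ l y + p 0 * F.φ l y)) * w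

/-- Unique continuation: at the midpoint `u` and its derivative vanish, hence also `p`, and the
constant Wronskians with the fundamental solutions give zero initial data at `0`. -/
theorem eq_zero_of_eqOn_zero (F : FundSystem Q L) (h : IsQuasiSol Q L l u p) (ha : 0 ≤ a)
    (hab : a < b) (hb : b ≤ L) (h0 : ∀ x ∈ Set.Icc a b, u x = 0) :
    ∀ y ∈ Set.Icc 0 L, u y = 0 ∧ p y = 0 := by
  have hm : (a + b) / 2 ∈ Set.Ioo a b := ⟨by linarith, by linarith⟩
  have hmL : (a + b) / 2 ∈ Set.Icc 0 L := ⟨by linarith, by linarith⟩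
  have hz := h0 _ (Set.Ioo_subset_Icc_self hm)
  have h1 := ((h _ hmL).1.mono (Set.Icc_subset_Icc ha hb)).hasDerivAt (Icc_mem_nhds hm.1 hm.2)
  have hc : u =ᶠ[nhds ((a + b) / 2)] fun _ => 0 := by
    filter_upwards [Icc_mem_nhds hm.1 hm.2] with y hy using h0 y hy
  have h2 := h1.unique ((hasDerivAt_const _ 0).congr_of_eventuallyEq hc)
  rw [hz, mul_zero, add_zero] at h2
  have w1 := h.wronskian (F.solφ l) hmL
  have w2 := h.wronskian (F.solθ l) hmL
  rw [hz, h2, F.φ_zero, F.φ'_zero] at w1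
  rw [hz, h2, F.θ_zero, F.θ'_zero] at w2
  intro y hy
  have hu : u 0 = 0 := by linarith
  have hp : p 0 = 0 := by linarith
  have := F.eq_comb h hy
  simpa [hu, hp] using this

theorem isQuasiSol_s (l x : ℝ) :
    IsQuasiSol Q L l (F.s l x) (fun y => F.θ l x * F.φ' l y - F.φ l x * F.θ' l y) := by
  have := (F.solφ l).comb (F.solθ l) (F.θ l x) (-F.φ l x)
  simp only [neg_mul, ← sub_eq_add_neg] at this
  exact this

theorem s_self (l x : ℝ) : F.s l x x = 0 := by
  simp only [s]; ring

/-- If `F.s l x` vanished again at `y`, its energy would be zero at both ends, which forces it to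
vanish identically; but its quasi-derivative at `x` is 1. -/
theorem s_ne_zero (ha : 0 ≤ a) (hb : b ≤ L) (hr : RiccatiOn Q l c D a b) {x y : ℝ}
    (hx : a ≤ x) (hxy : x < y) (hy : y ≤ b) : F.s l x y ≠ 0 := by
  intro h0
  have hxL : x ∈ Set.Icc 0 L := ⟨by linarith, by linarith⟩
  have h1 := ((F.isQuasiSol_s l x).energy (ha.trans hx) hxy (hy.trans hb) (hr.mono_set hx hy)).2
    (by simp [h0, s_self])
  have h2 := (F.eq_zero_of_eqOn_zero (F.isQuasiSol_s l x) (ha.trans hx) hxy (hy.trans hb) h1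
    x hxL).2
  rw [F.wronskian l hxL] at h2
  exact one_ne_zero h2

/-- The slope 1 at `x` makes the solution positive just to the right of `x`, and a later sign change
would produce a second zero. -/
theorem s_pos (ha : 0 ≤ a) (hb : b ≤ L) (hr : RiccatiOn Q l c D a b) {x y : ℝ}
    (hx : a ≤ x) (hxy : x < y) (hy : y ≤ b) : 0 < F.s l x y := by
  have hxL : x ∈ Set.Ico 0 L := ⟨by linarith, by linarith⟩
  have hxL' := Set.Ico_subset_Icc_self hxL
  have hd := (F.isQuasiSol_s l x x hxL').1.Ici_of_Icc hxL
  simp only [F.wronskian l hxL', s_self, mul_zero, add_zero] at hd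
  rw [← hasDerivWithinAt_Ioi_iff_Ici,
    hasDerivWithinAt_iff_tendsto_slope' Set.self_notMem_Ioi] at hd
  obtain ⟨z, hz, hzy⟩ := ((hd.eventually (lt_mem_nhds one_pos)).and
    (Ioo_mem_nhdsGT hxy)).exists
  have hzpos : 0 < F.s l x z := by
    rw [slope_def_field, s_self, sub_zero] at hz
    exact (div_pos_iff_of_pos_right (sub_pos.2 hzy.1)).1 hz
  by_contra hle
  rw [not_lt] at hle
  obtain ⟨w, hw, hw0⟩ := intermediate_value_Icc' hzy.2.le
    ((F.isQuasiSol_s l x).continuousOn_left.mono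
      (Set.Icc_subset_Icc (hxL.1.trans hzy.1.le) (hy.trans hb))) ⟨hle, hzpos.le⟩
  exact F.s_ne_zero ha hb hr hx (hzy.1.trans_le hw.1) (hw.2.trans hy) hw0

/-- Cramer's rule with determinant `F.s l a b`: the Dirichlet problem is solvable when its only
homogeneous solution is zero. -/
theorem exists_sol_of_boundary (hs : F.s l a b ≠ 0) (x y : ℝ) : ∃ A B, A * F.θ l a + B * F.φ l a = x ∧ A * F.θ l b + B * F.φ l b = y := by
  refine ⟨(x * F.φ l b - y * F.φ l a) / F.s l a b, (F.θ l a * y - F.θ l b * x) / F.s l a b, ?_, ?_⟩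
  all_goals
    field_simp
    simp only [s]
    ring

/-- The off-diagonal coefficient agrees with the one in `boundary_deriv_right`, where the Wronskian
enters. This symmetry is why the map from boundary values to outward quasi-derivatives comes from a
quadratic form. -/
theorem boundary_deriv_left (h : IsQuasiSol Q L l u p) (hs : F.s l a b ≠ 0)
    (ha : a ∈ Set.Icc 0 L) (hb : b ∈ Set.Icc 0 L) :
    p a = (F.s l a b)⁻¹ * u b - F.diagLeft l a b * u a := by
  have := F.sol_eq_comb h ha hb
  rw [this, diagLeft]
  field_simp
  ring

theorem boundary_deriv_right (h : IsQuasiSol Q L l u p) (hs : F.s l a b ≠ 0)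
    (ha : a ∈ Set.Icc 0 L) (hb : b ∈ Set.Icc 0 L) :
    p b = F.diagRight l a b * u b - (F.s l a b)⁻¹ * u a := by
  have h1 := (F.eq_comb h ha).1
  have h2 := F.eq_comb h hb
  have w := F.wronskian l hb
  rw [diagRight, h1, h2.1, h2.2]
  field_simp
  rw [s]
  linear_combination (-(u 0 * F.θ l a + p 0 * F.φ l a)) * w

/-- The boundary form `[u p]` of `[a, b]` as a quadratic form in the boundary values of `u`. -/
noncomputable def bform (l a b x y : ℝ) : ℝ :=
  F.diagLeft l a b * x ^ 2 + F.diagRight l a b * y ^ 2 - 2 * (F.s l a b)⁻¹ * (x * y)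

theorem bform_eq (h : IsQuasiSol Q L l u p) (hs : F.s l a b ≠ 0)
    (ha : a ∈ Set.Icc 0 L) (hb : b ∈ Set.Icc 0 L) :
    F.bform l a b (u a) (u b) = u b * p b - u a * p a := by
  rw [F.boundary_deriv_left h hs ha hb, F.boundary_deriv_right h hs ha hb, bform]
  ring

/-- The energy inequality for the solution with boundary values `x` and `y`. The lower bound
telescopes over consecutive pieces that share one affine function. -/
theorem bform_lower (ha : 0 ≤ a) (hab : a < b) (hb : b ≤ L) (hr : RiccatiOn Q l c D a b)
    (hs : F.s l a b ≠ 0) (x y : ℝ) :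
    (c + D * a) * x ^ 2 - (c + D * b) * y ^ 2 ≤ F.bform l a b x y ∧
    (F.bform l a b x y ≤ (c + D * a) * x ^ 2 - (c + D * b) * y ^ 2 → x = 0 ∧ y = 0) := by
  have haL : a ∈ Set.Icc 0 L := ⟨ha, hab.le.trans hb⟩
  have hbL : b ∈ Set.Icc 0 L := ⟨ha.trans hab.le, hb⟩
  obtain ⟨A, B, rfl, rfl⟩ := F.exists_sol_of_boundary hs x y
  have hu := (F.solθ l).comb (F.solφ l) A B
  have h1 := F.bform_eq hu hs haL hbL
  have h2 := hu.energy ha hab hb hr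
  rw [h1]
  exact ⟨by linarith [h2.1], fun h => ⟨h2.2 (by linarith) a ⟨le_rfl, hab.le⟩,
    h2.2 (by linarith) b ⟨hab.le, le_rfl⟩⟩⟩

/-- Both values of the form are boundary terms of solutions with the same boundary values, to which
`IsQuasiSol.comparison` applies. The Riccati inequality at the larger parameter suffices for both.
-/
theorem bform_strictAnti (hl : l < l') (ha : 0 ≤ a) (hab : a < b) (hb : b ≤ L)
    (hr : RiccatiOn Q l' c D a b) (x y : ℝ) :
    F.bform l' a b x y ≤ F.bform l a b x y ∧
    (F.bform l a b x y ≤ F.bform l' a b x y → x = 0 ∧ y = 0) := by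
  have haL : a ∈ Set.Icc 0 L := ⟨ha, hab.le.trans hb⟩
  have hbL : b ∈ Set.Icc 0 L := ⟨ha.trans hab.le, hb⟩
  have hs' := F.s_ne_zero ha hb hr le_rfl hab le_rfl
  have hs := F.s_ne_zero ha hb (hr.mono_param hl.le) le_rfl hab le_rfl
  obtain ⟨A, B, rfl, rfl⟩ := F.exists_sol_of_boundary hs x y
  obtain ⟨A', B', e1, e2⟩ := F.exists_sol_of_boundary hs'
    (A * F.θ l a + B * F.φ l a) (A * F.θ l b + B * F.φ l b)
  have hu := (F.solθ l).comb (F.solφ l) A B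
  have hv := (F.solθ l').comb (F.solφ l') A' B'
  have h1 := F.bform_eq hu hs haL hbL
  have h1' := F.bform_eq hv hs' haL hbL
  have h2 := hu.comparison hv hl ha hab hb hr e1.symm e2.symm
  simp only [e1, e2] at h1 h1' h2
  rw [h1, h1']
  exact ⟨h2.1, fun h => ⟨h2.2 h a ⟨le_rfl, hab.le⟩, h2.2 h b ⟨hab.le, le_rfl⟩⟩⟩

/-- On an interval without conjugate points, a solution which does not vanish at the end points
has exactly one zero if it changes sign, and no zero otherwise. -/
theorem zeros_of_riccatiOn (F : FundSystem Q L) (h : IsQuasiSol Q L l u p) (ha : 0 ≤ a) (hab : a < b) (hb : b ≤ L)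
    (hr : RiccatiOn Q l c D a b) (hub : u b ≠ 0) :
    (u a * u b < 0 → ∃ z ∈ Set.Ioo a b, u z = 0) ∧
    (∀ z ∈ Set.Ioo a b, u z = 0 → u a * u b < 0) ∧
    (∀ z ∈ Set.Ioo a b, ∀ z' ∈ Set.Ioo a b, u z = 0 → u z' = 0 → z = z') := by
  have hsub : Set.Ioo a b ⊆ Set.Icc 0 L :=
    Set.Ioo_subset_Icc_self.trans (Set.Icc_subset_Icc ha hb)
  have haL : a ∈ Set.Icc 0 L := ⟨ha, hab.le.trans hb⟩
  have hbL : b ∈ Set.Icc 0 L := ⟨ha.trans hab.le, hb⟩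
  have hcont : ContinuousOn u (Set.Icc a b) :=
    h.continuousOn_left.mono (Set.Icc_subset_Icc ha hb)
  have hform : ∀ z ∈ Set.Ioo a b, u z = 0 → ∀ y ∈ Set.Icc 0 L, u y = p z * F.s l z y := by
    intro z hz h0 y hy
    rw [F.sol_eq_comb h (hsub hz) hy, h0]
    ring
  have hp : ∀ z ∈ Set.Ioo a b, u z = 0 → p z ≠ 0 := by
    intro z hz h0 hpz
    exact hub (by rw [hform z hz h0 b hbL, hpz, zero_mul])
  refine ⟨fun hneg => ?_, fun z hz h0 => ?_, fun z hz z' hz' h0 h0' => ?_⟩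
  · rcases mul_neg_iff.1 hneg with ⟨h1, h2⟩ | ⟨h1, h2⟩
    · exact intermediate_value_Ioo' hab.le hcont ⟨h2, h1⟩
    · exact intermediate_value_Ioo hab.le hcont ⟨h1, h2⟩
  · have h1 := F.s_pos ha hb hr hz.1.le hz.2 le_rfl
    have h2 := F.s_pos ha hb hr le_rfl hz.1 hz.2.le
    have h3 : F.s l z a = -F.s l a z := by simp only [s]; ring
    rw [hform z hz h0 a haL, hform z hz h0 b hbL, h3]
    have := hp z hz h0
    have : 0 < p z ^ 2 := by positivity
    nlinarith [mul_pos this (mul_pos h1 h2)]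
  · by_contra hne
    wlog hlt : z < z' generalizing z z'
    · exact this z' hz' z hz h0' h0 (Ne.symm hne) (lt_of_le_of_ne (not_lt.1 hlt) (Ne.symm hne))
    rw [hform z hz h0 z' (hsub hz')] at h0'
    exact (mul_ne_zero (hp z hz h0) (F.s_pos ha hb hr hz.1.le hlt hz'.2.le).ne') h0'

end FundSystem

/-! ### Negative index and spectral flow of quadratic forms. -/

namespace QuadraticForm

variable {M : Type*} [NormedAddCommGroup M] [NormedSpace ℝ M] [FiniteDimensional ℝ M]

theorem posDef_restrict_iff {M : Type*} [AddCommGroup M] [Module ℝ M] {Q : QuadraticForm ℝ M}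
    {V : Submodule ℝ M} :
    (Q.restrict V).PosDef ↔ ∀ x ∈ V, x ≠ 0 → 0 < Q x := by
  simp [QuadraticMap.PosDef]

/-- A maximal negative definite subspace meets the radical only in zero, and `Q` is nonpositive on
their sum, so the strictly smaller `Q'` is negative definite there. -/
theorem sigNeg_add_finrank_radical_le {Q Q' : QuadraticForm ℝ M}
    (h : ∀ x, x ≠ 0 → Q' x < Q x) :
    sigNeg Q + Module.finrank ℝ Q.radical ≤ sigNeg Q' := by
  obtain ⟨V, hV, hneg⟩ := exists_finrank_eq_sigNeg_and_negDef Q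
  rw [posDef_restrict_iff] at hneg
  simp only [_root_.neg_apply, Left.neg_pos_iff] at hneg
  have hdisj : V ⊓ Q.radical = ⊥ := by
    rw [Submodule.eq_bot_iff]
    rintro x ⟨hx, hx'⟩
    by_contra hne
    have := hneg x hx hne
    rw [(QuadraticMap.mem_radical_iff'.1 hx').1] at this
    exact lt_irrefl _ this
  have hfin := Submodule.finrank_sup_add_finrank_inf_eq V Q.radical
  rw [hdisj, finrank_bot, add_zero, hV] at hfin
  rw [← hfin]
  refine le_sigNeg_of_negDef Q' (posDef_restrict_iff.2 fun x hx hne => ?_)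
  obtain ⟨v, hv, r, hr, rfl⟩ := Submodule.mem_sup.1 hx
  have h1 := h _ hne
  rw [add_comm v r, (QuadraticMap.mem_radical_iff'.1 hr).2] at h1
  have h2 : Q v ≤ 0 := by
    by_cases hv0 : v = 0
    · simp [hv0]
    · exact (hneg v hv hv0).le
  rw [_root_.neg_apply, add_comm v r]
  linarith

/-- Positivity on the compact unit sphere of a maximal positive definite subspace survives small
changes of `l`, and homogeneity extends it to the subspace. -/
theorem eventually_sigPos_le {Q : ℝ → QuadraticForm ℝ M} {l₀ : ℝ}
    (hcont : ∀ x, ContinuousAt (fun z : ℝ × M => Q z.1 z.2) (l₀, x)) :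
    ∀ᶠ l in nhds l₀, sigPos (Q l₀) ≤ sigPos (Q l) := by
  obtain ⟨V, hV, hpos⟩ := exists_finrank_eq_sigPos_and_posDef (Q l₀)
  rw [posDef_restrict_iff] at hpos
  have hK : IsCompact (Metric.sphere (0 : M) 1 ∩ (V : Set M)) :=
    (have : ProperSpace M := FiniteDimensional.proper ℝ M; isCompact_sphere 0 1).inter_right
      V.closed_of_finiteDimensional
  have hev := hK.eventually_forall_of_forall_eventually (x₀ := l₀)
    (P := fun l x => 0 < Q l x) (fun x hx => by
      have hx0 : x ≠ 0 := by
        rintro rfl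
        simpa using hx.1
      have := (hcont x).eventually (lt_mem_nhds (hpos x hx.2 hx0))
      exact this)
  filter_upwards [hev] with l hl
  rw [← hV]
  refine le_sigPos_of_posDef (Q l) (posDef_restrict_iff.2 fun x hx hne => ?_)
  have hn : 0 < ‖x‖ := norm_pos_iff.2 hne
  have := hl (‖x‖⁻¹ • x) ⟨by simp [norm_smul, hn.ne'], V.smul_mem _ hx⟩
  rw [QuadraticMap.map_smul, smul_eq_mul] at this
  exact (mul_pos_iff_of_pos_left (by positivity)).1 this

theorem eventually_sigNeg_le {Q : ℝ → QuadraticForm ℝ M} {l₀ : ℝ}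
    (hcont : ∀ x, ContinuousAt (fun z : ℝ × M => Q z.1 z.2) (l₀, x)) :
    ∀ᶠ l in nhds l₀, sigNeg (Q l₀) ≤ sigNeg (Q l) := by
  have := eventually_sigPos_le (Q := fun l => -Q l) (l₀ := l₀) fun x => (hcont x).neg
  simpa only [sigPos_neg] using this

/-- **Spectral flow.** For a continuous, strictly decreasing family of quadratic forms which is
positive definite near `-∞`, the number of parameters below `μ` where the form degenerates, counted
with the dimension of the radical, is the negative index at `μ`. -/
theorem encard_degenerate_eq_sigNeg {Q : ℝ → QuadraticForm ℝ M} {μ : ℝ}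
    (hcont : ∀ l ≤ μ, ∀ x, ContinuousAt (fun z : ℝ × M => Q z.1 z.2) (l, x))
    (hanti : ∀ l l', l < l' → l' ≤ μ → ∀ x, x ≠ 0 → Q l' x < Q l x)
    (hpos : ∃ a, ∀ l ≤ a, ∀ x, x ≠ 0 → 0 < Q l x) :
    {z : ℝ × ℕ | z.1 < μ ∧ z.2 < Module.finrank ℝ (Q z.1).radical}.encard = sigNeg (Q μ) := by
  have hstep : ∀ l l', l < l' → l' ≤ μ →
      sigNeg (Q l) + Module.finrank ℝ (Q l).radical ≤ sigNeg (Q l') :=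
    fun l l' h h' => sigNeg_add_finrank_radical_le (hanti l l' h h')
  have hmono : ∀ l l', l ≤ l' → l' ≤ μ → sigNeg (Q l) ≤ sigNeg (Q l') := by
    intro l l' h h'
    rcases h.eq_or_lt with rfl | h
    · exact le_rfl
    · exact (Nat.le_add_right _ _).trans (hstep l l' h h')
  have hupper : ∀ l₀ ≤ μ, ∀ᶠ l in nhds l₀,
      sigNeg (Q l) ≤ sigNeg (Q l₀) + Module.finrank ℝ (Q l₀).radical := by
    intro l₀ hl₀
    filter_upwards [eventually_sigPos_le (hcont l₀ hl₀)] with l hl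
    have h1 := sigPos_add_sigNeg_add_radical (Q := Q l₀)
    have h2 := sigPos_add_sigNeg_add_radical (Q := Q l)
    omega
  obtain ⟨a, ha⟩ := hpos
  have hzero : ∀ l ≤ a, sigNeg (Q l) = 0 := by
    intro l hl
    obtain ⟨V, hV, hneg⟩ := exists_finrank_eq_sigNeg_and_negDef (Q l)
    rw [posDef_restrict_iff] at hneg
    rw [← hV, Submodule.finrank_eq_zero, Submodule.eq_bot_iff]
    intro x hx
    by_contra hne
    have h1 := hneg x hx hne
    rw [_root_.neg_apply] at h1
    linarith [ha l hl x hne]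
  set S := {z : ℝ × ℕ | z.1 < μ ∧ z.2 < Module.finrank ℝ (Q z.1).radical}
  -- The degenerate pairs are enumerated by `g`: at a parameter `l` they fill the values from the
  -- negative index of `Q l` up to, but excluding, that index plus the nullity. By `hstep` these
  -- blocks are disjoint for different `l`.
  set g : ℝ × ℕ → ℕ := fun z => sigNeg (Q z.1) + z.2
  have hinj : Set.InjOn g S := by
    have hlt : ∀ z ∈ S, ∀ w ∈ S, z.1 < w.1 → g z < g w := by
      intro z hz w hw h
      have := hstep z.1 w.1 h hw.1.le
      have := hz.2
      simp only [g]
      omega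
    intro z hz w hw h
    rcases lt_trichotomy z.1 w.1 with h1 | h1 | h1
    · exact absurd h (hlt z hz w hw h1).ne
    · refine Prod.ext h1 ?_
      simp only [g, h1] at h
      omega
    · exact absurd h (hlt w hw z hz h1).ne'
  have himage : g '' S = Set.Iio (sigNeg (Q μ)) := by
    ext k
    constructor
    · rintro ⟨z, hz, rfl⟩
      have := hstep z.1 μ hz.1 le_rfl
      have := hz.2
      simp only [g, Set.mem_Iio]
      omega
    · intro hk
      rw [Set.mem_Iio] at hk
      -- The pair mapped to `k` sits at the infimum of the parameters at which the negative index
      -- exceeds `k`.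
      set T := {l | l ≤ μ ∧ k < sigNeg (Q l)}
      have hT : T.Nonempty := ⟨μ, le_rfl, hk⟩
      have hTb : BddBelow T := ⟨a, fun l hl => by
        by_contra hla
        have := hl.2
        rw [hzero l (not_le.1 hla).le] at this
        omega⟩
      have hleft : ∀ l ∈ T, ∃ l' ∈ T, l' < l := by
        intro l hl
        obtain ⟨l', h1, h2⟩ := (((eventually_sigNeg_le (hcont l hl.1)).filter_mono
          nhdsWithin_le_nhds).and self_mem_nhdsWithin).exists (f := nhdsWithin l (Set.Iio l))
        exact ⟨l', ⟨(le_of_lt h2).trans hl.1, hl.2.trans_le h1⟩, h2⟩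
      set ls := sInf T
      have hlsT : ls ∉ T := fun h => by
        obtain ⟨l', h1, h2⟩ := hleft ls h
        exact absurd (csInf_le hTb h1) (not_le.2 h2)
      have hlsμ : ls < μ := by
        refine lt_of_le_of_ne (csInf_le hTb ⟨le_rfl, hk⟩) fun h => hlsT ?_
        rw [h]
        exact ⟨le_rfl, hk⟩
      have h1 : sigNeg (Q ls) ≤ k := by
        by_contra h
        exact hlsT ⟨hlsμ.le, not_le.1 h⟩
      -- Just to the right of `ls` the index already exceeds `k`, and by `hupper` it can jump by at
      -- most the nullity at `ls`.
      have h2 : k < sigNeg (Q ls) + Module.finrank ℝ (Q ls).radical := by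
        obtain ⟨l, hl1, hl2⟩ := (((hupper ls hlsμ.le).filter_mono nhdsWithin_le_nhds).and
          (Ioo_mem_nhdsGT hlsμ)).exists (f := nhdsWithin ls (Set.Ioi ls))
        obtain ⟨l', hl', hlt⟩ := exists_lt_of_csInf_lt hT hl2.1
        exact (hl'.2.trans_le (hmono l' l hlt.le hl2.2.le)).trans_le hl1
      refine ⟨(ls, k - sigNeg (Q ls)), ⟨hlsμ, ?_⟩, ?_⟩
      · simp only
        omega
      · simp only [g]
        omega
  rw [← hinj.encard_image, himage, ← Finset.coe_range, Set.encard_coe_eq_coe_finsetCard,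
    Finset.card_range]

end QuadraticForm

/-! ### Discrete Schrödinger operators and sign changes. -/

/-- A discrete Schrödinger operator on the finite graph with vertex set `X` and edge set `P`:
diagonal coefficients at the two ends of every edge, an off-diagonal coefficient, and a potential
on the vertices. -/
structure DiscreteSchrodinger (X P : Type*) where
  lft : P → X
  rgt : P → X
  cl : P → ℝ
  cr : P → ℝ
  w : P → ℝ
  β : X → ℝ

namespace DiscreteSchrodinger

variable {X P : Type*} [Fintype X] [Fintype P] (A : DiscreteSchrodinger X P)

/-- The quadratic form of a discrete Schrödinger operator. -/
noncomputable def form : QuadraticForm ℝ (X → ℝ) :=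
  ∑ π, (A.cl π • QuadraticMap.linMulLin (LinearMap.proj (A.lft π)) (LinearMap.proj (A.lft π)) +
    A.cr π • QuadraticMap.linMulLin (LinearMap.proj (A.rgt π)) (LinearMap.proj (A.rgt π)) +
    (-2 * A.w π) • QuadraticMap.linMulLin (LinearMap.proj (A.lft π)) (LinearMap.proj (A.rgt π))) +
  ∑ x, A.β x • QuadraticMap.linMulLin (LinearMap.proj x) (LinearMap.proj x)

theorem form_apply (c : X → ℝ) : A.form c = ∑ π, (A.cl π * c (A.lft π) ^ 2 +
    A.cr π * c (A.rgt π) ^ 2 - 2 * A.w π * (c (A.lft π) * c (A.rgt π))) + ∑ x, A.β x * c x ^ 2 := by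
  simp only [form, _root_.add_apply, _root_.sum_apply, _root_.smul_apply,
    QuadraticMap.linMulLin_apply, LinearMap.proj_apply, smul_eq_mul]
  congr 1 <;> refine Finset.sum_congr rfl fun _ _ => by ring

open Classical in
/-- The discrete Schrödinger operator itself. -/
noncomputable def op (c : X → ℝ) (x : X) : ℝ :=
  ∑ π, ((if A.lft π = x then A.cl π * c (A.lft π) - A.w π * c (A.rgt π) else 0) +
    (if A.rgt π = x then A.cr π * c (A.rgt π) - A.w π * c (A.lft π) else 0)) + A.β x * c x

theorem sum_mul_op (g c : X → ℝ) : ∑ x, g x * A.op c x =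
    ∑ π, (g (A.lft π) * (A.cl π * c (A.lft π) - A.w π * c (A.rgt π)) +
      g (A.rgt π) * (A.cr π * c (A.rgt π) - A.w π * c (A.lft π))) + ∑ x, A.β x * (g x * c x) := by
  classical
  simp only [op, mul_add, Finset.sum_add_distrib (s := (Finset.univ : Finset X)), Finset.mul_sum]
  congr 1
  · rw [Finset.sum_comm]
    refine Finset.sum_congr rfl fun π _ => ?_
    rw [Finset.sum_add_distrib]
    simp
  · exact Finset.sum_congr rfl fun _ _ => by ring

theorem form_eq_sum (c : X → ℝ) : A.form c = ∑ x, c x * A.op c x := by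
  rw [sum_mul_op, form_apply]
  congr 1 <;> exact Finset.sum_congr rfl fun _ _ => by ring

theorem form_add (c d : X → ℝ) :
    A.form (c + d) = A.form c + A.form d + 2 * ∑ x, d x * A.op c x := by
  simp only [sum_mul_op, form_apply, Pi.add_apply, mul_add, Finset.mul_sum]
  have e1 : ∀ a b c d e f : ℝ, (a + b) + (c + d) + (e + f) = (a + c + e) + (b + d + f) := by
    intros; ring
  rw [e1, ← Finset.sum_add_distrib, ← Finset.sum_add_distrib, ← Finset.sum_add_distrib,
    ← Finset.sum_add_distrib]
  congr 1 <;> exact Finset.sum_congr rfl fun _ _ => by ring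

/-- For the forward direction the polar form is tested on `A.op c` itself, which gives a vanishing
sum of squares. -/
theorem mem_radical_iff {c : X → ℝ} : c ∈ A.form.radical ↔ A.op c = 0 := by
  rw [QuadraticMap.mem_radical_iff']
  constructor
  · rintro ⟨h0, h⟩
    have h1 := h (A.op c)
    rw [form_add, h0] at h1
    have h2 : ∑ x, A.op c x * A.op c x = 0 := by linarith
    rw [Finset.sum_eq_zero_iff_of_nonneg fun x _ => mul_self_nonneg _] at h2
    exact funext fun x => mul_self_eq_zero.1 (h2 x (Finset.mem_univ x))
  · intro h
    have h0 : A.form c = 0 := by simp [form_eq_sum, h]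
    exact ⟨h0, fun n => by simp [form_add, h0, h]⟩

/-- The ground state transform with respect to an element of the kernel. -/
theorem form_mul {c : X → ℝ} (hc : A.op c = 0) (y : X → ℝ) :
    A.form (y * c) =
      ∑ π, A.w π * (c (A.lft π) * c (A.rgt π)) * (y (A.rgt π) - y (A.lft π)) ^ 2 := by
  -- Pairing the kernel equation with `y ^ 2 * c` gives an expression equal to zero; subtracting it
  -- from the form cancels all diagonal terms and the vertex potential.
  have h := A.sum_mul_op (fun x => y x ^ 2 * c x) c
  simp only [hc, Pi.zero_apply, mul_zero, Finset.sum_const_zero] at h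
  rw [← sub_zero (A.form _), h, form_apply]
  simp only [Pi.mul_apply]
  rw [add_sub_add_comm, ← Finset.sum_sub_distrib, ← Finset.sum_sub_distrib,
    Finset.sum_eq_zero (s := Finset.univ (α := X)) fun _ _ => by ring, add_zero]
  exact Finset.sum_congr rfl fun _ _ => by ring

/-- On a graph without cycles, the negative index of a discrete Schrödinger operator with a nowhere
vanishing element `c` in its kernel is the number of edges on which `c` changes sign. -/
theorem sigNeg_form (hw : ∀ π, 0 < A.w π)
    (hsurj : ∀ d : P → ℝ, ∃ y : X → ℝ, ∀ π, y (A.rgt π) - y (A.lft π) = d π)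
    {c : X → ℝ} (hc : A.op c = 0) (hne : ∀ x, c x ≠ 0) :
    sigNeg A.form = {π | c (A.lft π) * c (A.rgt π) < 0}.ncard := by
  classical
  set N : Set P := {π | c (A.lft π) * c (A.rgt π) < 0}
  have hcard : Module.finrank ℝ (N → ℝ) = N.ncard := by
    rw [Module.finrank_fintype_fun_eq_card, Set.ncard_eq_toFinset_card', Set.toFinset_card]
  let diff : (X → ℝ) →ₗ[ℝ] (P → ℝ) := 
    LinearMap.funLeft ℝ ℝ A.rgt - LinearMap.funLeft ℝ ℝ A.lft
  have hdiff : ∀ y π, diff y π = y (A.rgt π) - y (A.lft π) := fun _ _ => rfl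
  let mulc : (X → ℝ) →ₗ[ℝ] (X → ℝ) := LinearMap.mulLeft ℝ c
  have hmulc : ∀ y, mulc y = y * c := fun y => mul_comm _ _
  apply le_antisymm
  · obtain ⟨V, hV, hneg⟩ := exists_finrank_eq_sigNeg_and_negDef A.form
    rw [QuadraticForm.posDef_restrict_iff] at hneg
    -- A vector whose increments, after division by `c`, vanish on all sign-changing edges has
    -- nonnegative form. Hence these increments separate the points of a negative definite subspace.
    let T : V →ₗ[ℝ] (N → ℝ) := (LinearMap.funLeft ℝ ℝ (Subtype.val : N → P)) ∘ₗ diff ∘ₗ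
      (LinearMap.mulLeft ℝ (c⁻¹)) ∘ₗ V.subtype
    have hT : Function.Injective T := by
      rw [injective_iff_map_eq_zero]
      intro x hx
      by_contra hx0
      have h1 := hneg x x.2 (by simpa using hx0)
      have h2 : (x : X → ℝ) = (c⁻¹ * x) * c := by
        funext i
        have := hne i
        simp only [Pi.mul_apply, Pi.inv_apply]
        field_simp
      rw [_root_.neg_apply, h2, A.form_mul hc] at h1
      have h3 : 0 ≤ ∑ π, A.w π * (c (A.lft π) * c (A.rgt π)) *
          ((c⁻¹ * (x : X → ℝ)) (A.rgt π) - (c⁻¹ * (x : X → ℝ)) (A.lft π)) ^ 2 := by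
        refine Finset.sum_nonneg fun π _ => ?_
        by_cases hπ : π ∈ N
        · have : (c⁻¹ * (x : X → ℝ)) (A.rgt π) - (c⁻¹ * (x : X → ℝ)) (A.lft π) = 0 :=
            congrFun hx ⟨π, hπ⟩
          rw [this]; simp
        · have h4 : 0 ≤ c (A.lft π) * c (A.rgt π) := not_lt.1 hπ
          have := (hw π).le
          positivity
      linarith
    rw [← hV, ← hcard]
    exact LinearMap.finrank_le_finrank_of_injective hT
  · have hs : LinearMap.range diff = ⊤ := LinearMap.range_eq_top.2 fun d => by
      obtain ⟨y, hy⟩ := hsurj d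
      exact ⟨y, funext hy⟩
    obtain ⟨sec, hsec⟩ := diff.exists_rightInverse_of_surjective hs
    have hsec' : ∀ d, diff (sec d) = d := fun d => LinearMap.congr_fun hsec d
    let ext : (N → ℝ) →ₗ[ℝ] (P → ℝ) := Function.ExtendByZero.linearMap ℝ (Subtype.val : N → P)
    have hext : ∀ d (π : N), ext d π = d π := fun d π =>
      Subtype.val_injective.extend_apply d 0 π
    have hext' : ∀ d (π : P), π ∉ N → ext d π = 0 := fun d π hπ =>
      Function.extend_apply' (f := (Subtype.val : N → P)) d (0 : P → ℝ) π
        (by rintro ⟨a, rfl⟩; exact hπ a.2)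
    -- Conversely, increments are prescribed on the sign-changing edges and set to zero on the
    -- others, which makes the form negative definite on the image.
    let T : (N → ℝ) →ₗ[ℝ] (X → ℝ) := mulc ∘ₗ sec ∘ₗ ext
    have hval : ∀ d, A.form (T d) = ∑ π, A.w π * (c (A.lft π) * c (A.rgt π)) * (ext d π) ^ 2 := by
      intro d
      have : T d = sec (ext d) * c := hmulc _
      rw [this, A.form_mul hc]
      refine Finset.sum_congr rfl fun π _ => ?_
      rw [← hdiff, hsec']
    have hnegT : ∀ d, d ≠ 0 → A.form (T d) < 0 := by
      intro d hd
      obtain ⟨π₀, hπ₀⟩ := Function.ne_iff.1 hd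
      rw [hval]
      refine Finset.sum_neg' (fun π _ => ?_) ⟨π₀, Finset.mem_univ _, ?_⟩
      · by_cases hπ : π ∈ N
        · exact mul_nonpos_of_nonpos_of_nonneg
            (mul_nonpos_of_nonneg_of_nonpos (hw π).le (le_of_lt hπ)) (sq_nonneg _)
        · rw [hext' d π hπ]; simp
      · refine mul_neg_of_neg_of_pos (mul_neg_of_pos_of_neg (hw _) π₀.2) ?_
        rw [hext]
        exact sq_pos_of_ne_zero hπ₀
    have hT : Function.Injective T := by
      rw [injective_iff_map_eq_zero]
      intro d hd
      by_contra hd0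
      have := hnegT d hd0
      rw [hd, map_zero] at this
      exact lt_irrefl _ this
    rw [← hcard, ← LinearMap.finrank_range_of_inj hT]
    refine le_sigNeg_of_negDef A.form (QuadraticForm.posDef_restrict_iff.2 ?_)
    rintro _ ⟨d, rfl⟩ hx
    rw [_root_.neg_apply, Left.neg_pos_iff]
    exact hnegT d (by rintro rfl; simp at hx)

end DiscreteSchrodinger

/-! ### Equivalence of the `H²` equation and the quasi-derivative system on an edge. -/

/-- The primitive, vanishing at `0`, of the restriction of `q` to `(0, L)`. -/
noncomputable def edgePrimitive (q : ℝ → ℝ) (L x : ℝ) : ℝ :=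
  ∫ t in (0 : ℝ)..x, (Set.Ioo 0 L).indicator q t

section Edge

variable {q : ℝ → ℝ} {L : ℝ}

theorem integrable_indicator_of_memLp (hq : MemLp q 2 (volume.restrict (Set.Ioo 0 L))) :
    Integrable ((Set.Ioo 0 L).indicator q) :=
  (integrable_indicator_iff measurableSet_Ioo).2 (hq.integrable (by norm_num))

theorem continuous_edgePrimitive (hq : MemLp q 2 (volume.restrict (Set.Ioo 0 L))) :
    Continuous (edgePrimitive q L) :=
  intervalIntegral.continuous_primitive (fun _ _ => (integrable_indicator_of_memLp hq).intervalIntegrable) 0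

theorem intervalIntegral_indicator_mul (U : ℝ → ℝ) {x : ℝ} (hx : x ∈ Set.Icc 0 L) :
    ∫ t in (0 : ℝ)..x, (Set.Ioo 0 L).indicator q t * U t = ∫ t in (0 : ℝ)..x, q t * U t := by
  rw [intervalIntegral.integral_of_le hx.1, intervalIntegral.integral_of_le hx.1,
    integral_Ioc_eq_integral_Ioo, integral_Ioc_eq_integral_Ioo]
  refine setIntegral_congr_fun measurableSet_Ioo fun t ht => ?_
  have ht' : t ∈ Set.Ioo 0 L := ⟨ht.1, ht.2.trans_le hx.2⟩
  simp [ht']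

/-- Integration by parts against the primitive of an integrable function. -/
theorem primitive_mul_eq {g U D : ℝ → ℝ} (hg : Integrable g)
    (hU : ∀ x ∈ Set.Icc 0 L, HasDerivWithinAt U (D x) (Set.Icc 0 L) x)
    (hD : ContinuousOn D (Set.Icc 0 L)) {x : ℝ} (hx : x ∈ Set.Icc 0 L) :
    (∫ t in (0 : ℝ)..x, g t) * U x =
      (∫ t in (0 : ℝ)..x, g t * U t) + ∫ t in (0 : ℝ)..x, (∫ y in (0 : ℝ)..t, g y) * D t := by
  have hsub : Set.Icc 0 x ⊆ Set.Icc 0 L := Set.Icc_subset_Icc_right hx.2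
  have hG : AbsolutelyContinuousOnInterval (fun t => ∫ y in (0 : ℝ)..t, g y) 0 x :=
    hg.intervalIntegrable.absolutelyContinuousOnInterval_intervalIntegral (by simp)
  obtain ⟨K, hK⟩ := (isCompact_Icc (a := (0 : ℝ)) (b := L)).exists_bound_of_continuousOn hD
  have hK0 : 0 ≤ K := (norm_nonneg _).trans (hK x hx)
  -- A bounded derivative makes `U` Lipschitz, hence absolutely continuous, as integration by parts
  -- requires.
  have hlip : LipschitzOnWith K.toNNReal U (Set.uIcc 0 x) := by
    rw [Set.uIcc_of_le hx.1]
    refine (convex_Icc 0 x).lipschitzOnWith_of_nnnorm_hasDerivWithin_le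
      (fun t ht => (hU t (hsub ht)).mono hsub) fun t ht => ?_
    rw [← NNReal.coe_le_coe, coe_nnnorm, Real.coe_toNNReal _ hK0]
    exact hK t (hsub ht)
  have key := hG.integral_mul_deriv_eq_deriv_mul hlip.absolutelyContinuousOnInterval
  have e1 : ∫ t in (0 : ℝ)..x, (∫ y in (0 : ℝ)..t, g y) * deriv U t =
      ∫ t in (0 : ℝ)..x, (∫ y in (0 : ℝ)..t, g y) * D t := by
    rw [intervalIntegral.integral_of_le hx.1, intervalIntegral.integral_of_le hx.1,
      integral_Ioc_eq_integral_Ioo, integral_Ioc_eq_integral_Ioo]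
    refine setIntegral_congr_fun measurableSet_Ioo fun t ht => ?_
    have ht' : t ∈ Set.Ioo 0 L := ⟨ht.1, ht.2.trans_le hx.2⟩
    rw [((hU t (Set.Ioo_subset_Icc_self ht')).hasDerivAt (Icc_mem_nhds ht'.1 ht'.2)).deriv]
  have e2 : ∫ t in (0 : ℝ)..x, deriv (fun t => ∫ y in (0 : ℝ)..t, g y) t * U t =
      ∫ t in (0 : ℝ)..x, g t * U t := by
    refine intervalIntegral.integral_congr_ae ?_
    filter_upwards [(hg.intervalIntegrable (a := 0) (b := x)).ae_hasDerivAt_integral] with t ht h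
    rw [(ht (Set.uIoc_subset_uIcc h) 0 (by simp)).deriv]
  rw [e1, e2] at key
  simp only [intervalIntegral.integral_same, zero_mul, sub_zero] at key
  linarith

theorem hasDerivWithinAt_primitive_Icc {g : ℝ → ℝ} (hg : ContinuousOn g (Set.Icc 0 L)) {x : ℝ}
    (hx : x ∈ Set.Icc 0 L) :
    HasDerivWithinAt (fun x => ∫ t in (0 : ℝ)..x, g t) (g x) (Set.Icc 0 L) x := by
  have hL : 0 ≤ L := hx.1.trans hx.2
  -- Extending `g` by constants makes it continuous on the line, so the two-sided fundamental
  -- theorem also covers the end points.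
  set G := Set.IccExtend hL ((Set.Icc 0 L).domRestrict g)
  have hG : Continuous G := (continuousOn_iff_continuous_domRestrict.1 hg).Icc_extend'
  have hGg : ∀ t ∈ Set.Icc 0 L, G t = g t := fun t ht => Set.IccExtend_of_mem hL _ ht
  have h := (hG.integral_hasStrictDerivAt 0 x).hasDerivAt.hasDerivWithinAt (s := Set.Icc 0 L)
  rw [hGg x hx] at h
  refine h.congr_of_mem (fun y hy => ?_) hx
  refine intervalIntegral.integral_congr fun t ht => ?_
  rw [Set.uIcc_of_le hy.1] at ht
  exact (hGg t ⟨ht.1, ht.2.trans hy.2⟩).symm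

theorem intervalIntegrable_mul_of_continuousOn (hq : MemLp q 2 (volume.restrict (Set.Ioo 0 L)))
    {U : ℝ → ℝ} (hU : ContinuousOn U (Set.Icc 0 L)) {x : ℝ} (hx : x ∈ Set.Icc 0 L) :
    IntervalIntegrable (fun t => q t * U t) volume 0 x := by
  have h1 : IntervalIntegrable q volume 0 x := by
    rw [intervalIntegrable_iff_integrableOn_Ioo_of_le hx.1]
    exact IntegrableOn.mono_set (hq.integrable (by norm_num)) (Set.Ioo_subset_Ioo_right hx.2)
  refine h1.mul_continuousOn ?_
  rw [Set.uIcc_of_le hx.1]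
  exact hU.mono (Set.Icc_subset_Icc_right hx.2)

/-- The integral form of `U'' = (q - l) U` gives the quasi-derivative system. -/
theorem IsQuasiSol.of_integral_eq (hq : MemLp q 2 (volume.restrict (Set.Ioo 0 L))) {l : ℝ}
    {U D : ℝ → ℝ} (hU : ∀ x ∈ Set.Icc 0 L, HasDerivWithinAt U (D x) (Set.Icc 0 L) x)
    (hD : ∀ x ∈ Set.Icc 0 L, D x = D 0 + ∫ t in (0 : ℝ)..x, (q t * U t - l * U t)) :
    IsQuasiSol (edgePrimitive q L) L l U (fun x => D x - edgePrimitive q L x * U x) := by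
  have hUc : ContinuousOn U (Set.Icc 0 L) := fun x hx => (hU x hx).continuousWithinAt
  have hint : ∀ x ∈ Set.Icc 0 L, ∫ t in (0 : ℝ)..x, (q t * U t - l * U t) =
      (∫ t in (0 : ℝ)..x, (Set.Ioo 0 L).indicator q t * U t) - ∫ t in (0 : ℝ)..x, l * U t := by
    intro x hx
    rw [intervalIntegral_indicator_mul U hx, intervalIntegral.integral_sub
      (intervalIntegrable_mul_of_continuousOn hq hUc hx)]
    refine ContinuousOn.intervalIntegrable ?_
    rw [Set.uIcc_of_le hx.1]
    exact (continuousOn_const.mul hUc).mono (Set.Icc_subset_Icc_right hx.2)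
  have hDc : ContinuousOn D (Set.Icc 0 L) := by
    refine ContinuousOn.congr (f := fun x => D 0 +
      ((∫ t in (0 : ℝ)..x, (Set.Ioo 0 L).indicator q t * U t) - ∫ t in (0 : ℝ)..x, l * U t)) ?_
      fun x hx => by rw [hD x hx, hint x hx]
    refine continuousOn_const.add (ContinuousOn.sub ?_ ?_)
    · intro x hx
      have hx' := hx.1.trans hx.2
      have : IntervalIntegrable (fun t => q t * U t) volume 0 L :=
        intervalIntegrable_mul_of_continuousOn hq hUc ⟨hx', le_rfl⟩
      have h2 := intervalIntegral.continuousOn_primitive_interval' this Set.left_mem_uIcc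
      rw [Set.uIcc_of_le hx'] at h2
      exact (h2.congr fun y hy => intervalIntegral_indicator_mul U hy) x hx
    · exact fun x hx =>
        (hasDerivWithinAt_primitive_Icc (continuousOn_const.mul hUc) hx).continuousWithinAt
  have hQc := continuous_edgePrimitive hq
  intro x hx
  refine ⟨(hU x hx).congr_deriv (by ring), ?_⟩
  -- Integration by parts cancels the term with `q`. What remains has a continuous integrand, so `p`
  -- is differentiable at every point although `D` itself need not be.
  have hp : ∀ y ∈ Set.Icc 0 L, D y - edgePrimitive q L y * U y =
      D 0 + ∫ t in (0 : ℝ)..y, (-l * U t - edgePrimitive q L t * D t) := by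
    intro y hy
    have hc : ∀ {g : ℝ → ℝ}, ContinuousOn g (Set.Icc 0 L) → IntervalIntegrable g volume 0 y := by
      intro g hg
      refine ContinuousOn.intervalIntegrable ?_
      rw [Set.uIcc_of_le hy.1]
      exact hg.mono (Set.Icc_subset_Icc_right hy.2)
    have h1 := primitive_mul_eq (integrable_indicator_of_memLp hq) hU hDc hy
    rw [intervalIntegral.integral_sub (hc (g := fun t => -l * U t) (continuousOn_const.mul hUc))
      (hc (g := fun t => edgePrimitive q L t * D t) (hQc.continuousOn.mul hDc)), hD y hy, hint y hy]
    simp only [neg_mul, intervalIntegral.integral_neg]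
    change edgePrimitive q L y * U y = _ + ∫ t in (0 : ℝ)..y, edgePrimitive q L t * D t at h1
    linarith
  refine (((hasDerivWithinAt_primitive_Icc (g := fun t => -l * U t - edgePrimitive q L t * D t)
    ((continuousOn_const.mul hUc).sub (hQc.continuousOn.mul hDc)) hx).const_add (D 0)).congr_of_mem
      hp hx).congr_deriv ?_
  ring

/-- The derivative `p + Q u` of a solution of the quasi-derivative system is absolutely continuous
with the expected derivative. -/
theorem IsQuasiSol.integral_eq (hq : MemLp q 2 (volume.restrict (Set.Ioo 0 L))) {l : ℝ}
    {U p : ℝ → ℝ} (h : IsQuasiSol (edgePrimitive q L) L l U p) {x : ℝ} (hx : x ∈ Set.Icc 0 L) :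
    p x + edgePrimitive q L x * U x =
      p 0 + edgePrimitive q L 0 * U 0 + ∫ t in (0 : ℝ)..x, (q t * U t - l * U t) := by
  have hQc := continuous_edgePrimitive hq
  have hUc := h.continuousOn_left
  have hDc : ContinuousOn (fun x => p x + edgePrimitive q L x * U x) (Set.Icc 0 L) :=
    h.continuousOn_right.add (hQc.continuousOn.mul hUc)
  have h0 : edgePrimitive q L 0 = 0 := by simp [edgePrimitive]
  have hsub : Set.Icc 0 x ⊆ Set.Icc 0 L := Set.Icc_subset_Icc_right hx.2
  have hc : ∀ {g : ℝ → ℝ}, ContinuousOn g (Set.Icc 0 L) → IntervalIntegrable g volume 0 x := by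
    intro g hg
    refine ContinuousOn.intervalIntegrable ?_
    rw [Set.uIcc_of_le hx.1]
    exact hg.mono hsub
  have h1 := primitive_mul_eq (integrable_indicator_of_memLp hq) (fun x hx => (h x hx).1) hDc hx
  rw [intervalIntegral_indicator_mul U hx] at h1
  change edgePrimitive q L x * U x = _ + ∫ t in (0 : ℝ)..x, edgePrimitive q L t *
    (p t + edgePrimitive q L t * U t) at h1
  have h2 : ∫ t in (0 : ℝ)..x, (-l * U t - edgePrimitive q L t *
      (p t + edgePrimitive q L t * U t)) = p x - p 0 := by
    refine intervalIntegral.integral_eq_sub_of_hasDerivAt_of_le hx.1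
      (h.continuousOn_right.mono hsub) (fun t ht => ?_)
      (hc ((continuousOn_const.mul hUc).sub (hQc.continuousOn.mul hDc)))
    have ht' : t ∈ Set.Ioo 0 L := ⟨ht.1, ht.2.trans_le hx.2⟩
    exact (((h t (Set.Ioo_subset_Icc_self ht')).2).hasDerivAt
      (Icc_mem_nhds ht'.1 ht'.2)).congr_deriv (by ring)
  rw [intervalIntegral.integral_sub (hc (g := fun t => -l * U t) (continuousOn_const.mul hUc))
    (hc (g := fun t => edgePrimitive q L t * (p t + edgePrimitive q L t * U t))
      (hQc.continuousOn.mul hDc))] at h2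
  rw [intervalIntegral.integral_sub (intervalIntegrable_mul_of_continuousOn hq hUc hx)
    (hc (g := fun t => l * U t) (continuousOn_const.mul hUc)), h0]
  simp only [neg_mul, intervalIntegral.integral_neg] at h2
  linarith

/-- `u` is an `H²` solution of `-u'' + q u = l u` exactly when its real and imaginary parts solve
the quasi-derivative system. -/
theorem sobolev_iff_isQuasiSol (hL : 0 < L) (hq : MemLp q 2 (volume.restrict (Set.Ioo 0 L)))
    {l : ℝ} {u : ℝ → ℂ} :
    (∃ w : ℝ → ℂ, HasSobolevSecondDeriv L u w ∧ ∀ᵐ x ∂(volume.restrict (Set.Ioo 0 L)),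
      -w x + (q x : ℂ) * u x = (l : ℂ) * u x) ↔
    (∃ p, IsQuasiSol (edgePrimitive q L) L l (fun x => (u x).re) p) ∧
    (∃ p, IsQuasiSol (edgePrimitive q L) L l (fun x => (u x).im) p) := by
  constructor
  · rintro ⟨w, hw, hae⟩
    -- The potential and the parameter are real, so every real-linear functional carries solutions
    -- to solutions; the real and imaginary parts are two instances.
    have key : ∀ Λ : ℂ →L[ℝ] ℝ,
        ∃ p, IsQuasiSol (edgePrimitive q L) L l (fun x => Λ (u x)) p := by
      intro Λ
      refine ⟨_, IsQuasiSol.of_integral_eq hq (D := fun x => Λ (derivWithin u (Set.Icc 0 L) x))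
        (fun x hx => ?_) fun x hx => ?_⟩
      · exact Λ.hasFDerivAt.comp_hasDerivWithinAt x (hw.2.1 x hx).hasDerivWithinAt
      · rw [hw.2.2 x hx, map_add, ← Λ.intervalIntegral_comp_comm (hw.intervalIntegrable hx)]
        congr 1
        rw [intervalIntegral.integral_of_le hx.1, intervalIntegral.integral_of_le hx.1,
          integral_Ioc_eq_integral_Ioo, integral_Ioc_eq_integral_Ioo]
        refine integral_congr_ae ?_
        have := ae_mono (Measure.restrict_mono (Set.Ioo_subset_Ioo_right hx.2) le_rfl) hae
        filter_upwards [this] with t ht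
        have e : w t = q t • u t - l • u t := by
          simp only [Complex.real_smul]
          linear_combination -ht
        rw [e, map_sub, map_smul, map_smul, smul_eq_mul, smul_eq_mul]
    exact ⟨key Complex.reCLM, key Complex.imCLM⟩
  · rintro ⟨⟨p₁, h₁⟩, ⟨p₂, h₂⟩⟩
    have hd : ∀ x ∈ Set.Icc 0 L, HasDerivWithinAt u
        (((p₁ x + edgePrimitive q L x * (u x).re : ℝ) : ℂ) +
          ((p₂ x + edgePrimitive q L x * (u x).im : ℝ) : ℂ) * Complex.I) (Set.Icc 0 L) x := by
      intro x hx
      have := (h₁ x hx).1.ofReal_comp.add ((h₂ x hx).1.ofReal_comp.mul_const Complex.I)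
      refine this.congr_of_mem (fun y _ => ?_) hx
      exact (Complex.re_add_im (u y)).symm
    have huc : ContinuousOn u (Set.Icc 0 L) := fun x hx => (hd x hx).continuousWithinAt
    have hud : UniqueDiffOn ℝ (Set.Icc 0 L) := uniqueDiffOn_Icc hL
    refine ⟨fun x => ((q x - l : ℝ) : ℂ) * u x, ⟨?_, fun x hx => (hd x hx).differentiableWithinAt,
      fun x hx => ?_⟩, Filter.Eventually.of_forall fun x => by push_cast; ring⟩
    · obtain ⟨K, hK⟩ := (isCompact_Icc (a := (0 : ℝ)) (b := L)).exists_bound_of_continuousOn huc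
      have hu : MemLp u ⊤ (volume.restrict (Set.Ioo 0 L)) := by
        refine memLp_top_of_bound ((huc.mono Set.Ioo_subset_Icc_self).aestronglyMeasurable
          measurableSet_Ioo) K ?_
        filter_upwards [ae_restrict_mem measurableSet_Ioo] with x hx
        exact hK x (Set.Ioo_subset_Icc_self hx)
      have hql : MemLp (fun x => ((q x - l : ℝ) : ℂ)) 2 (volume.restrict (Set.Ioo 0 L)) :=
        (hq.sub (memLp_const l)).ofReal
      exact hu.mul hql
    · have h0 : (0 : ℝ) ∈ Set.Icc 0 L := ⟨le_rfl, hL.le⟩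
      rw [(hd x hx).derivWithin (hud x hx), (hd 0 h0).derivWithin (hud 0 h0)]
      have hint : IntervalIntegrable (fun x => ((q x - l : ℝ) : ℂ) * u x) volume 0 x := by
        have h1 : IntervalIntegrable q volume 0 x := by
          rw [intervalIntegrable_iff_integrableOn_Ioo_of_le hx.1]
          exact IntegrableOn.mono_set (hq.integrable (by norm_num))
            (Set.Ioo_subset_Ioo_right hx.2)
        have h2 : IntervalIntegrable (fun x => ((q x - l : ℝ) : ℂ)) volume 0 x :=
          by
          rw [intervalIntegrable_iff] at h1 ⊢
          exact (h1.sub (intervalIntegrable_iff.1 intervalIntegrable_const)).ofReal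
        refine h2.mul_continuousOn ?_
        rw [Set.uIcc_of_le hx.1]
        exact huc.mono (Set.Icc_subset_Icc_right hx.2)
      have e₁ := h₁.integral_eq hq hx
      have e₂ := h₂.integral_eq hq hx
      have hre : (∫ t in (0 : ℝ)..x, ((q t - l : ℝ) : ℂ) * u t).re =
          ∫ t in (0 : ℝ)..x, (q t * (u t).re - l * (u t).re) := by
        have := Complex.reCLM.intervalIntegral_comp_comm hint
        simp only [Complex.reCLM_apply, Complex.re_ofReal_mul] at this
        rw [← this]
        exact intervalIntegral.integral_congr fun t _ => by ring
      have him : (∫ t in (0 : ℝ)..x, ((q t - l : ℝ) : ℂ) * u t).im =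
          ∫ t in (0 : ℝ)..x, (q t * (u t).im - l * (u t).im) := by
        have := Complex.imCLM.intervalIntegral_comp_comm hint
        simp only [Complex.imCLM_apply, Complex.im_ofReal_mul] at this
        rw [← this]
        exact intervalIntegral.integral_congr fun t _ => by ring
      apply Complex.ext <;> beta_reduce
      · simp only [Complex.add_re, hre]
        simpa using e₁
      · simp only [Complex.add_im, him]
        simpa using e₂

end Edge

/-! ### Real solutions on the metric graph. -/

namespace MetricGraph

variable {V E : Type*} {Γ : MetricGraph V E}

theorem onEdge_zero (e : E) : (onEdge e 0 : Γ.Point) = Point.vertex (Γ.src e) := by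
  simp [onEdge]

theorem onEdge_len (e : E) : (onEdge e (Γ.len e) : Γ.Point) = Point.vertex (Γ.tgt e) := by
  simp [onEdge, (Γ.len_pos e).not_ge]

theorem onEdge_interior (e : E) {x : ℝ} (hx : x ∈ Set.Ioo 0 (Γ.len e)) :
    (onEdge e x : Γ.Point) = Point.interior e x hx := by
  rw [onEdge, dif_pos hx]

/-- The primitives of the potential along the edges. -/
noncomputable def primitive (Γ : MetricGraph V E) (q : E → ℝ → ℝ) (e : E) : ℝ → ℝ :=
  edgePrimitive (q e) (Γ.len e)

open Classical in
/-- The coefficient of the vertex condition in terms of quasi-derivatives. -/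
noncomputable def quasiCoeff [Fintype E] (Γ : MetricGraph V E) (q : E → ℝ → ℝ) (a : V → ℝ)
    (v : V) : ℝ :=
  a v + ∑ e, if Γ.tgt e = v then Γ.primitive q e (Γ.len e) else 0

open Classical in
/-- Real solutions of the eigenvalue problem, in terms of quasi-derivatives. -/
def IsRealSol [Fintype E] (q : E → ℝ → ℝ) (a : V → ℝ) (l : ℝ) (u : Γ.Point → ℝ) : Prop :=
  ∃ p : E → ℝ → ℝ,
    (∀ e, IsQuasiSol (Γ.primitive q e) (Γ.len e) l (fun x => u (onEdge e x)) (p e)) ∧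
    ∀ v, ∑ e, ((if Γ.src e = v then p e 0 else 0) +
      (if Γ.tgt e = v then -p e (Γ.len e) else 0)) = Γ.quasiCoeff q a v * u (Point.vertex v)

theorem primitive_zero (q : E → ℝ → ℝ) (e : E) : Γ.primitive q e 0 = 0 := by
  simp [primitive, edgePrimitive]

theorem edgeDeriv_eq {q : E → ℝ → ℝ} {l : ℝ} {f : Γ.Point → ℂ} {e : E} {p₁ p₂ : ℝ → ℝ}
    (h₁ : IsQuasiSol (Γ.primitive q e) (Γ.len e) l (fun x => (along f e x).re) p₁)
    (h₂ : IsQuasiSol (Γ.primitive q e) (Γ.len e) l (fun x => (along f e x).im) p₂)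
    {x : ℝ} (hx : x ∈ Set.Icc 0 (Γ.len e)) :
    (edgeDeriv f e x).re = p₁ x + Γ.primitive q e x * (along f e x).re ∧
    (edgeDeriv f e x).im = p₂ x + Γ.primitive q e x * (along f e x).im := by
  have hd : HasDerivWithinAt (along f e)
      (((p₁ x + Γ.primitive q e x * (along f e x).re : ℝ) : ℂ) +
        ((p₂ x + Γ.primitive q e x * (along f e x).im : ℝ) : ℂ) * Complex.I)
      (Set.Icc 0 (Γ.len e)) x := by
    have := (h₁ x hx).1.ofReal_comp.add ((h₂ x hx).1.ofReal_comp.mul_const Complex.I)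
    refine this.congr_of_mem (fun y _ => ?_) hx
    exact (Complex.re_add_im (along f e y)).symm
  rw [edgeDeriv, hd.derivWithin (uniqueDiffOn_Icc (Γ.len_pos e) x hx)]
  simp

/-- All coefficients are real, so the problem splits into real and imaginary parts. The primitive
vanishes at the source of an edge, where `u' = p`; at the target `-u' = -p - Q u`, and these extra
terms are absorbed into `quasiCoeff`. -/
theorem mem_eigenspace_iff [Fintype E] {q : E → ℝ → ℝ}
    (hq : ∀ e, MemLp (q e) 2 (volume.restrict (Set.Ioo 0 (Γ.len e)))) {a : V → ℝ} {l : ℝ}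
    {f : Γ.Point → ℂ} :
    f ∈ Γ.eigenspace q (fun v => (a v : WithTop ℝ)) l ↔
      IsRealSol q a l (fun x => (f x).re) ∧ IsRealSol q a l (fun x => (f x).im) := by
  classical
  have hvert : ∀ p₁ p₂ : E → ℝ → ℝ,
      (∀ e, IsQuasiSol (Γ.primitive q e) (Γ.len e) l (fun x => (along f e x).re) (p₁ e)) →
      (∀ e, IsQuasiSol (Γ.primitive q e) (Γ.len e) l (fun x => (along f e x).im) (p₂ e)) →
      ∀ v, (DeltaCondition f v (a v) ↔
        (∑ e, ((if Γ.src e = v then p₁ e 0 else 0) + (if Γ.tgt e = v then -p₁ e (Γ.len e) else 0))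
          = Γ.quasiCoeff q a v * (f (Point.vertex v)).re) ∧
        (∑ e, ((if Γ.src e = v then p₂ e 0 else 0) + (if Γ.tgt e = v then -p₂ e (Γ.len e) else 0))
          = Γ.quasiCoeff q a v * (f (Point.vertex v)).im)) := by
    intro p₁ p₂ h₁ h₂ v
    have h0 : ∀ e, (0 : ℝ) ∈ Set.Icc 0 (Γ.len e) := fun e => ⟨le_rfl, (Γ.len_pos e).le⟩
    have hL : ∀ e, Γ.len e ∈ Set.Icc 0 (Γ.len e) := fun e => ⟨(Γ.len_pos e).le, le_rfl⟩
    have hre : (outwardDerivSum f v).re = ∑ e, ((if Γ.src e = v then p₁ e 0 else 0) +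
        (if Γ.tgt e = v then -p₁ e (Γ.len e) else 0)) -
        (∑ e, if Γ.tgt e = v then Γ.primitive q e (Γ.len e) else 0) * (f (Point.vertex v)).re := by
      rw [outwardDerivSum, Complex.re_sum, Finset.sum_mul, ← Finset.sum_sub_distrib]
      refine Finset.sum_congr rfl fun e _ => ?_
      have e1 := (edgeDeriv_eq (h₁ e) (h₂ e) (h0 e)).1
      have e2 := (edgeDeriv_eq (h₁ e) (h₂ e) (hL e)).1
      rw [along, onEdge_len] at e2
      rw [primitive_zero] at e1
      split_ifs with i1 i2 i2
      · rw [i2] at e2; simp [e1, e2]; ring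
      · simp [e1]
      · rw [i2] at e2; simp [e2]; ring
      · simp
    have him : (outwardDerivSum f v).im = ∑ e, ((if Γ.src e = v then p₂ e 0 else 0) +
        (if Γ.tgt e = v then -p₂ e (Γ.len e) else 0)) -
        (∑ e, if Γ.tgt e = v then Γ.primitive q e (Γ.len e) else 0) * (f (Point.vertex v)).im := by
      rw [outwardDerivSum, Complex.im_sum, Finset.sum_mul, ← Finset.sum_sub_distrib]
      refine Finset.sum_congr rfl fun e _ => ?_
      have e1 := (edgeDeriv_eq (h₁ e) (h₂ e) (h0 e)).2
      have e2 := (edgeDeriv_eq (h₁ e) (h₂ e) (hL e)).2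
      rw [along, onEdge_len] at e2
      rw [primitive_zero] at e1
      split_ifs with i1 i2 i2
      · rw [i2] at e2; simp [e1, e2]; ring
      · simp [e1]
      · rw [i2] at e2; simp [e2]; ring
      · simp
    have hcond : DeltaCondition f v (a v) ↔
        outwardDerivSum f v = (a v : ℂ) * f (Point.vertex v) := by
      constructor
      · exact fun h => h.2 _ rfl
      · exact fun h => ⟨fun h' => absurd h' (WithTop.coe_ne_top), fun r hr => by
          rw [← WithTop.coe_injective hr]; exact h⟩
    rw [hcond, Complex.ext_iff, hre, him, Complex.re_ofReal_mul, Complex.im_ofReal_mul, quasiCoeff,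
      add_mul, add_mul, sub_eq_iff_eq_add, sub_eq_iff_eq_add]
  constructor
  · rintro ⟨hs, hv⟩
    have := fun e => (sobolev_iff_isQuasiSol (Γ.len_pos e) (hq e)).1 (hs e)
    choose p₁ h₁ using fun e => (this e).1
    choose p₂ h₂ using fun e => (this e).2
    exact ⟨⟨p₁, h₁, fun v => ((hvert p₁ p₂ h₁ h₂ v).1 (hv v)).1⟩,
      ⟨p₂, h₂, fun v => ((hvert p₁ p₂ h₁ h₂ v).1 (hv v)).2⟩⟩
  · rintro ⟨⟨p₁, h₁, k₁⟩, ⟨p₂, h₂, k₂⟩⟩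
    exact ⟨fun e => (sobolev_iff_isQuasiSol (Γ.len_pos e) (hq e)).2 ⟨⟨p₁ e, h₁ e⟩, ⟨p₂ e, h₂ e⟩⟩,
      fun v => (hvert p₁ p₂ h₁ h₂ v).2 ⟨k₁ v, k₂ v⟩⟩

/-! ### Subdivided edges and the discrete operator of the pieces. -/

/-- A subdivision of every edge of a metric graph into `m + 1` pieces. -/
structure Subdivision (Γ : MetricGraph V E) (m : ℕ) where
  t : E → ℕ → ℝ
  t_zero : ∀ e, t e 0 = 0
  t_last : ∀ e, t e (m + 1) = Γ.len e
  t_lt : ∀ e k, k < m + 1 → t e k < t e (k + 1)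

namespace Subdivision

variable {m : ℕ} (S : Γ.Subdivision m)

theorem t_strictMono (e : E) {j k : ℕ} (hjk : j < k) (hk : k ≤ m + 1) : S.t e j < S.t e k := by
  induction k with
  | zero => omega
  | succ k ih =>
    rcases (Nat.lt_succ_iff.1 hjk).eq_or_lt with rfl | h
    · exact S.t_lt e _ (by omega)
    · exact (ih h (by omega)).trans (S.t_lt e k (by omega))

theorem t_mono (e : E) {j k : ℕ} (hjk : j ≤ k) (hk : k ≤ m + 1) : S.t e j ≤ S.t e k := by
  rcases hjk.eq_or_lt with rfl | h
  · exact le_rfl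
  · exact (S.t_strictMono e h hk).le

theorem t_mem (e : E) {k : ℕ} (hk : k ≤ m + 1) : S.t e k ∈ Set.Icc 0 (Γ.len e) := by
  constructor
  · rw [← S.t_zero e]; exact S.t_mono e (Nat.zero_le k) hk
  · rw [← S.t_last e]; exact S.t_mono e hk le_rfl

/-- The `k`-th node on the edge `e`. -/
def node (Γ : MetricGraph V E) (m : ℕ) (e : E) (k : ℕ) : V ⊕ E × Fin m :=
  if k = 0 then Sum.inl (Γ.src e)
  else if h : k - 1 < m then Sum.inr (e, ⟨k - 1, h⟩) else Sum.inl (Γ.tgt e)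

theorem node_zero (e : E) : node Γ m e 0 = Sum.inl (Γ.src e) := rfl

theorem node_succ (e : E) (j : Fin m) : node Γ m e (j + 1) = Sum.inr (e, j) := by
  simp [node]

theorem node_last (e : E) : node Γ m e (m + 1) = Sum.inl (Γ.tgt e) := by
  simp [node]

theorem node_eq_inl_iff {e : E} {k : ℕ} {v : V} (hk : k < m + 1) :
    node Γ m e k = Sum.inl v ↔ k = 0 ∧ Γ.src e = v := by
  rcases k with _ | k
  · simp [node]
  · simp [node, Nat.lt_of_succ_lt_succ hk]

theorem node_succ_eq_inl_iff {e : E} {k : ℕ} {v : V} (hk : k < m + 1) :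
    node Γ m e (k + 1) = Sum.inl v ↔ k = m ∧ Γ.tgt e = v := by
  rcases (Nat.lt_succ_iff.1 hk).eq_or_lt with rfl | h
  · simp [node]
  · simp [node, h, h.ne]

theorem node_eq_inr_iff {e e' : E} {k : ℕ} {j : Fin m} (hk : k < m + 1) :
    node Γ m e k = Sum.inr (e', j) ↔ k = j + 1 ∧ e = e' := by
  rcases k with _ | k
  · simp [node]
  · simp [node, Nat.lt_of_succ_lt_succ hk, Fin.ext_iff, and_comm]

theorem node_succ_eq_inr_iff {e e' : E} {k : ℕ} {j : Fin m} (hk : k < m + 1) :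
    node Γ m e (k + 1) = Sum.inr (e', j) ↔ k = j ∧ e = e' := by
  rcases (Nat.lt_succ_iff.1 hk).eq_or_lt with rfl | h
  · simp [node, j.2.ne']
  · simp [node, h, Fin.ext_iff, and_comm]

/-- The point of the metric graph belonging to a node. -/
noncomputable def pt : V ⊕ E × Fin m → Γ.Point :=
  Sum.elim Point.vertex fun z => onEdge z.1 (S.t z.1 (z.2 + 1))

theorem pt_node (e : E) {k : ℕ} (hk : k ≤ m + 1) : S.pt (node Γ m e k) = onEdge e (S.t e k) := by
  rcases k with _ | k
  · rw [node_zero, S.t_zero, onEdge_zero, pt, Sum.elim_inl]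
  · rcases (Nat.le_of_succ_le_succ hk).eq_or_lt with rfl | h
    · rw [node_last, S.t_last, onEdge_len, pt, Sum.elim_inl]
    · rw [node_succ e ⟨k, h⟩, pt, Sum.elim_inr]

variable [Fintype E] {q : E → ℝ → ℝ} (a : V → ℝ)
  (F : ∀ e, FundSystem (Γ.primitive q e) (Γ.len e)) (l : ℝ)

/-- The discrete Schrödinger operator formed by the Dirichlet-to-Neumann maps of the pieces. -/
noncomputable def discrete : DiscreteSchrodinger (V ⊕ E × Fin m) (E × Fin (m + 1)) where
  lft π := node Γ m π.1 π.2
  rgt π := node Γ m π.1 (π.2 + 1)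
  cl π := (F π.1).diagLeft l (S.t π.1 π.2) (S.t π.1 (π.2 + 1))
  cr π := (F π.1).diagRight l (S.t π.1 π.2) (S.t π.1 (π.2 + 1))
  w π := ((F π.1).s l (S.t π.1 π.2) (S.t π.1 (π.2 + 1)))⁻¹
  β := Sum.elim (Γ.quasiCoeff q a) 0

/-- The quasi-derivative at the left end of a piece determined by the boundary values. -/
noncomputable def derivLeft (c : V ⊕ E × Fin m → ℝ) (e : E) (k : ℕ) : ℝ :=
  ((F e).s l (S.t e k) (S.t e (k + 1)))⁻¹ * c (node Γ m e (k + 1)) -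
    (F e).diagLeft l (S.t e k) (S.t e (k + 1)) * c (node Γ m e k)

/-- The quasi-derivative at the right end of a piece determined by the boundary values. -/
noncomputable def derivRight (c : V ⊕ E × Fin m → ℝ) (e : E) (k : ℕ) : ℝ :=
  (F e).diagRight l (S.t e k) (S.t e (k + 1)) * c (node Γ m e (k + 1)) -
    ((F e).s l (S.t e k) (S.t e (k + 1)))⁻¹ * c (node Γ m e k)

-- Only the first and last pieces of an edge touch its end vertices, so a kernel element satisfies
-- exactly the vertex condition in quasi-derivatives.
open Classical in
theorem op_discrete_inl (c : V ⊕ E × Fin m → ℝ) (v : V) :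
    (S.discrete a F l).op c (Sum.inl v) = ∑ e, ((if Γ.src e = v then -S.derivLeft F l c e 0 else 0) +
      (if Γ.tgt e = v then S.derivRight F l c e m else 0)) +
      Γ.quasiCoeff q a v * c (Sum.inl v) := by
  rw [DiscreteSchrodinger.op, Fintype.sum_prod_type]
  congr 1
  refine Finset.sum_congr rfl fun e _ => ?_
  rw [Finset.sum_add_distrib]
  congr 1
  · rw [Finset.sum_eq_single 0]
    · simp [discrete, derivLeft, node_eq_inl_iff (Nat.succ_pos m)]
    · intro k _ hk
      rw [if_neg]
      simp only [discrete, node_eq_inl_iff k.2]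
      exact fun h => hk (Fin.ext h.1)
    · simp
  · rw [Finset.sum_eq_single (Fin.last m)]
    · simp [discrete, derivRight, node_succ_eq_inl_iff (Nat.lt_succ_self m)]
    · intro k _ hk
      rw [if_neg]
      simp only [discrete, node_succ_eq_inl_iff k.2]
      exact fun h => hk (Fin.ext h.1)
    · simp

-- At an inner node the operator is the jump of the quasi-derivative, so the kernel condition says
-- that neighbouring pieces join smoothly.
open Classical in
theorem op_discrete_inr (c : V ⊕ E × Fin m → ℝ) (e : E) (j : Fin m) :
    (S.discrete a F l).op c (Sum.inr (e, j)) =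
      S.derivRight F l c e j - S.derivLeft F l c e (j + 1) := by
  rw [DiscreteSchrodinger.op, Finset.sum_add_distrib, Finset.sum_eq_single (e, j.succ),
    Finset.sum_eq_single (e, j.castSucc)]
  · have h1 : (S.discrete a F l).lft (e, j.succ) = Sum.inr (e, j) := node_succ e j
    have h2 : (S.discrete a F l).rgt (e, j.castSucc) = Sum.inr (e, j) := node_succ e j
    rw [if_pos h1, if_pos h2]
    simp only [discrete, derivLeft, derivRight, Sum.elim_inr, Pi.zero_apply, Fin.val_succ,
      Fin.val_castSucc]
    ring
  · rintro ⟨e', k⟩ _ hk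
    rw [if_neg]
    simp only [discrete, node_succ_eq_inr_iff k.2]
    rintro ⟨h, rfl⟩
    exact hk (by rw [Fin.ext (a := k) (b := j.castSucc) h])
  · simp
  · rintro ⟨e', k⟩ _ hk
    rw [if_neg]
    simp only [discrete, node_eq_inr_iff k.2]
    rintro ⟨h, rfl⟩
    exact hk (by rw [Fin.ext (a := k) (b := j.succ) (by rw [h, Fin.val_succ])])
  · simp

variable {a F l}

/-- The values at the nodes of a solution form an element of the kernel of the discrete operator. -/
theorem op_discrete_of_isRealSol
    (hs : ∀ e k, k < m + 1 → (F e).s l (S.t e k) (S.t e (k + 1)) ≠ 0)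
    {u : Γ.Point → ℝ} (hu : IsRealSol q a l u) : (S.discrete a F l).op (u ∘ S.pt) = 0 := by
  classical
  obtain ⟨p, hp, hv⟩ := hu
  have hL : ∀ e k, k < m + 1 → S.derivLeft F l (u ∘ S.pt) e k = p e (S.t e k) := by
    intro e k hk
    rw [(F e).boundary_deriv_left (hp e) (hs e k hk) (S.t_mem e hk.le) (S.t_mem e hk), derivLeft]
    simp only [Function.comp_apply, S.pt_node e hk.le, S.pt_node e hk]
  have hR : ∀ e k, k < m + 1 → S.derivRight F l (u ∘ S.pt) e k = p e (S.t e (k + 1)) := by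
    intro e k hk
    rw [(F e).boundary_deriv_right (hp e) (hs e k hk) (S.t_mem e hk.le) (S.t_mem e hk), derivRight]
    simp only [Function.comp_apply, S.pt_node e hk.le, S.pt_node e hk]
  funext x
  rcases x with v | ⟨e, j⟩
  · rw [op_discrete_inl]
    have := hv v
    simp only [hL _ 0 (Nat.succ_pos m), hR _ m (Nat.lt_succ_self m), S.t_zero, S.t_last]
    change _ + Γ.quasiCoeff q a v * u (Point.vertex v) = 0
    rw [← this, ← Finset.sum_add_distrib]
    refine Finset.sum_eq_zero fun e _ => ?_
    split_ifs <;> ring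
  · have := j.2
    rw [op_discrete_inr, hL _ _ (by omega), hR _ _ (by omega), sub_self, Pi.zero_apply]

/-- Zeros at the first two nodes of an edge give zero initial data at its source, hence the solution
vanishes on the whole edge. -/
theorem isRealSol_eq_zero (hs : ∀ e k, k < m + 1 → (F e).s l (S.t e k) (S.t e (k + 1)) ≠ 0)
    {u : Γ.Point → ℝ} (hu : IsRealSol q a l u) (h0 : u ∘ S.pt = 0) : u = 0 := by
  obtain ⟨p, hp, -⟩ := hu
  have hn : ∀ e k, k ≤ m + 1 → u (onEdge e (S.t e k)) = 0 := fun e k hk => by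
    rw [← S.pt_node e hk]
    exact congrFun h0 _
  funext z
  rcases z with v | ⟨e, x, hx⟩
  · exact congrFun h0 (Sum.inl v)
  · have m0 := S.t_mem e (Nat.zero_le (m + 1))
    have h1 := (F e).sol_eq_comb (hp e) m0 (S.t_mem e (k := 0 + 1) (by omega))
    rw [hn e 0 (by omega), hn e _ (by omega), zero_mul, zero_add] at h1
    have h2 := (mul_eq_zero.1 h1.symm).resolve_right (hs e 0 (Nat.succ_pos m))
    have h3 := (F e).sol_eq_comb (hp e) m0 (Set.Ioo_subset_Icc_self hx)
    rw [hn e 0 (by omega), h2, onEdge_interior e hx] at h3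
    simpa using h3

/-- Every element of the kernel of the discrete operator consists of the values of a solution. -/
theorem exists_isRealSol (hs : ∀ e k, k < m + 1 → (F e).s l (S.t e k) (S.t e (k + 1)) ≠ 0)
    {c : V ⊕ E × Fin m → ℝ} (hc : (S.discrete a F l).op c = 0) :
    ∃ u : Γ.Point → ℝ, IsRealSol q a l u ∧ u ∘ S.pt = c := by
  classical
  have hpiece : ∀ e k, ∃ A B, k < m + 1 →
      A * (F e).θ l (S.t e k) + B * (F e).φ l (S.t e k) = c (node Γ m e k) ∧
      A * (F e).θ l (S.t e (k + 1)) + B * (F e).φ l (S.t e (k + 1)) = c (node Γ m e (k + 1)) := by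
    intro e k
    by_cases hk : k < m + 1
    · obtain ⟨A, B, h⟩ := (F e).exists_sol_of_boundary (hs e k hk) (c (node Γ m e k))
        (c (node Γ m e (k + 1)))
      exact ⟨A, B, fun _ => h⟩
    · exact ⟨0, 0, fun h => absurd h hk⟩
  choose A B hAB using hpiece
  have hsol : ∀ e k, IsQuasiSol (Γ.primitive q e) (Γ.len e) l
      (fun x => A e k * (F e).θ l x + B e k * (F e).φ l x)
      (fun x => A e k * (F e).θ' l x + B e k * (F e).φ' l x) := fun e k =>
    ((F e).solθ l).comb ((F e).solφ l) (A e k) (B e k)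
  have hL : ∀ e k, k < m + 1 → A e k * (F e).θ' l (S.t e k) + B e k * (F e).φ' l (S.t e k) =
      S.derivLeft F l c e k := by
    intro e k hk
    have := (F e).boundary_deriv_left (hsol e k) (hs e k hk) (S.t_mem e hk.le) (S.t_mem e hk)
    simp only [(hAB e k hk).1, (hAB e k hk).2] at this
    rw [this, derivLeft]
  have hR : ∀ e k, k < m + 1 →
      A e k * (F e).θ' l (S.t e (k + 1)) + B e k * (F e).φ' l (S.t e (k + 1)) =
      S.derivRight F l c e k := by
    intro e k hk
    have := (F e).boundary_deriv_right (hsol e k) (hs e k hk) (S.t_mem e hk.le) (S.t_mem e hk)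
    simp only [(hAB e k hk).1, (hAB e k hk).2] at this
    rw [this, derivRight]
  -- Value and quasi-derivative of neighbouring pieces agree at their common node; as the Wronskian
  -- is 1, their coefficients agree, so one formula serves the whole edge.
  have hconst : ∀ e k, k < m + 1 → A e k = A e 0 ∧ B e k = B e 0 := by
    intro e k hk
    induction k with
    | zero => exact ⟨rfl, rfl⟩
    | succ k ih =>
      have hk' : k < m := by omega
      obtain ⟨hA, hB⟩ := ih (by omega)
      rw [← hA, ← hB]
      have h0 := congrFun hc (Sum.inr (e, ⟨k, hk'⟩))
      rw [op_discrete_inr, Pi.zero_apply, sub_eq_zero] at h0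
      simp only at h0
      have h1 := (hAB e k (by omega)).2.trans (hAB e (k + 1) hk).1.symm
      have h2 := (hR e k (by omega)).trans (h0.trans (hL e (k + 1) hk).symm)
      have w := (F e).wronskian l (S.t_mem e hk.le)
      constructor
      · linear_combination (-(F e).φ' l (S.t e (k + 1))) * h1 + (F e).φ l (S.t e (k + 1)) * h2 +
          (A e (k + 1) - A e k) * (-w)
      · linear_combination ((F e).θ' l (S.t e (k + 1))) * h1 - (F e).θ l (S.t e (k + 1)) * h2 +
          (B e (k + 1) - B e k) * (-w)
  let u : Γ.Point → ℝ := fun z => match z with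
    | Point.vertex v => c (Sum.inl v)
    | Point.interior e x _ => A e 0 * (F e).θ l x + B e 0 * (F e).φ l x
  have hedge : ∀ e, ∀ x ∈ Set.Icc 0 (Γ.len e),
      u (onEdge e x) = A e 0 * (F e).θ l x + B e 0 * (F e).φ l x := by
    intro e x hx
    rcases hx.1.eq_or_lt with rfl | h0
    · have := (hAB e 0 (Nat.succ_pos m)).1
      rw [S.t_zero, node_zero] at this
      rw [onEdge_zero, this]
    rcases hx.2.eq_or_lt with rfl | h1
    · have := (hAB e m (Nat.lt_succ_self m)).2
      rw [S.t_last, node_last, (hconst e m (Nat.lt_succ_self m)).1,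
        (hconst e m (Nat.lt_succ_self m)).2] at this
      rw [onEdge_len, this]
    · rw [onEdge_interior e ⟨h0, h1⟩]
  refine ⟨u, ⟨fun e x => A e 0 * (F e).θ' l x + B e 0 * (F e).φ' l x, fun e x hx => ?_,
    fun v => ?_⟩, ?_⟩
  · have := hsol e 0 x hx
    simp only [hedge e x hx]
    exact ⟨this.1.congr_of_mem (fun y hy => hedge e y hy) hx, this.2⟩
  · have h0 := congrFun hc (Sum.inl v)
    rw [op_discrete_inl, Pi.zero_apply] at h0
    change _ = Γ.quasiCoeff q a v * c (Sum.inl v)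
    rw [← eq_neg_iff_add_eq_zero, ← neg_eq_iff_eq_neg, ← Finset.sum_neg_distrib] at h0
    rw [← h0]
    refine Finset.sum_congr rfl fun e _ => ?_
    have e1 := hL e 0 (Nat.succ_pos m)
    have e2 := hR e m (Nat.lt_succ_self m)
    rw [S.t_zero] at e1
    rw [S.t_last, (hconst e m (Nat.lt_succ_self m)).1, (hconst e m (Nat.lt_succ_self m)).2] at e2
    simp only [e1, e2]
    split_ifs <;> ring
  · funext z
    rcases z with v | ⟨e, j⟩
    · rfl
    · have hj := j.2
      have h1 := (hAB e j (by omega)).2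
      rw [(hconst e j (by omega)).1, (hconst e j (by omega)).2, node_succ,
        ← hedge e _ (S.t_mem e (by omega))] at h1
      exact h1

/-- The multiplicity of an eigenvalue is the dimension of the kernel of the discrete operator. -/
theorem eigenvalueMultiplicity_eq [Fintype V]
    (hq : ∀ e, MemLp (q e) 2 (volume.restrict (Set.Ioo 0 (Γ.len e))))
    (hs : ∀ e k, k < m + 1 → (F e).s l (S.t e k) (S.t e (k + 1)) ≠ 0) :
    Γ.eigenvalueMultiplicity q (fun v => (a v : WithTop ℝ)) l =
      Module.finrank ℝ (S.discrete a F l).form.radical := by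
  set W := Γ.eigenspace q (fun v => (a v : WithTop ℝ)) l
  set K := (S.discrete a F l).form.radical
  let T : W →ₗ[ℝ] (V ⊕ E × Fin m → ℝ) × (V ⊕ E × Fin m → ℝ) :=
    { toFun := fun f => (fun z => (f.1 (S.pt z)).re, fun z => (f.1 (S.pt z)).im)
      map_add' := fun f g => by ext <;> simp
      map_smul' := fun r f => by ext <;> simp }
  have hTinj : Function.Injective T := by
    rw [injective_iff_map_eq_zero]
    rintro ⟨f, hf⟩ h
    obtain ⟨h1, h2⟩ := (mem_eigenspace_iff hq).1 hf
    have e1 := S.isRealSol_eq_zero hs h1 (congrArg Prod.fst h)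
    have e2 := S.isRealSol_eq_zero hs h2 (congrArg Prod.snd h)
    refine Subtype.ext (funext fun z => Complex.ext (congrFun e1 z) (congrFun e2 z))
  have hTrange : LinearMap.range T = K.prod K := by
    ext ⟨c, d⟩
    rw [LinearMap.mem_range, Submodule.mem_prod, DiscreteSchrodinger.mem_radical_iff,
      DiscreteSchrodinger.mem_radical_iff]
    constructor
    · rintro ⟨⟨f, hf⟩, h⟩
      obtain ⟨h1, h2⟩ := (mem_eigenspace_iff hq).1 hf
      rw [← show _ = c from congrArg Prod.fst h, ← show _ = d from congrArg Prod.snd h]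
      exact ⟨S.op_discrete_of_isRealSol hs h1, S.op_discrete_of_isRealSol hs h2⟩
    · rintro ⟨hc, hd⟩
      obtain ⟨u, hu, rfl⟩ := S.exists_isRealSol hs hc
      obtain ⟨v, hv, rfl⟩ := S.exists_isRealSol hs hd
      exact ⟨⟨fun z => ⟨u z, v z⟩, (mem_eigenspace_iff hq).2 ⟨hu, hv⟩⟩, rfl⟩
  have hfin : Module.Finite ℝ W := Module.Finite.of_injective T hTinj
  have hfinC : Module.Finite ℂ W := Module.Finite.of_restrictScalars_finite ℝ ℂ W
  -- Real and imaginary parts range independently over the kernel, and the factor 2 is removed on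
  -- passing from real to complex dimension.
  have h1 : Module.finrank ℝ W = 2 * Module.finrank ℝ K := by
    have h2 : LinearMap.range (K.subtype.prodMap K.subtype) = K.prod K := by
      rw [LinearMap.range_prodMap, Submodule.range_subtype]
    rw [← LinearMap.finrank_range_of_inj hTinj, hTrange, ← h2, LinearMap.finrank_range_of_inj
      (K.injective_subtype.prodMap K.injective_subtype), Module.finrank_prod, two_mul]
  rw [finrank_real_of_complex] at h1
  rw [eigenvalueMultiplicity, ← Module.finrank_eq_rank, map_natCast]
  congr 1
  exact Nat.eq_of_mul_eq_mul_left two_pos h1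

end Subdivision

end MetricGraph

/-! ### Continuity of the coefficients in the parameter. -/

namespace FundSystem

variable {Q : ℝ → ℝ} {L : ℝ} (F : FundSystem Q L) {l a b : ℝ}

theorem continuousAt_coeff (hQ : Continuous Q) (ha : a ∈ Set.Icc 0 L) (hb : b ∈ Set.Icc 0 L)
    (hs : F.s l a b ≠ 0) :
    ContinuousAt (fun l => F.diagLeft l a b) l ∧ ContinuousAt (fun l => F.diagRight l a b) l ∧
      ContinuousAt (fun l => (F.s l a b)⁻¹) l := by
  have h1 := F.continuous_θ hQ ha
  have h2 := F.continuous_θ hQ hb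
  have h3 := F.continuous_θ' hQ ha
  have h4 := F.continuous_θ' hQ hb
  have h5 := F.continuous_φ hQ ha
  have h6 := F.continuous_φ hQ hb
  have h7 := F.continuous_φ' hQ ha
  have h8 := F.continuous_φ' hQ hb
  have hsc : Continuous (fun l => F.s l a b) := by
    unfold s
    fun_prop
  refine ⟨ContinuousAt.div ?_ hsc.continuousAt hs, ContinuousAt.div ?_ hsc.continuousAt hs,
    hsc.continuousAt.inv₀ hs⟩
  · exact ((h2.mul h7).sub (h6.mul h3)).continuousAt
  · exact ((h1.mul h8).sub (h5.mul h4)).continuousAt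

end FundSystem

/-! ### Potentials on trees, fine subdivisions and zeros. -/

namespace MetricGraph

variable {V E : Type*} {Γ : MetricGraph V E}

theorem IsTree.eq_of_forall_edge (hΓ : Γ.IsTree) {y : V → ℝ}
    (h : ∀ e, y (Γ.tgt e) = y (Γ.src e)) (u v : V) : y u = y v := by
  obtain ⟨p⟩ := hΓ.2.2.connected.preconnected u v
  induction p with
  | nil => rfl
  | cons hadj _ ih =>
    rw [← ih]
    rw [toSimpleGraph, SimpleGraph.fromRel_adj] at hadj
    rcases hadj.2 with ⟨e, rfl, rfl⟩ | ⟨e, rfl, rfl⟩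
    · exact (h e).symm
    · exact h e

/-- The indicator function of a vertex without edges would be constant along every edge, hence
constant by connectedness. -/
theorem IsTree.exists_edge (hΓ : Γ.IsTree) [Nonempty E] (v : V) :
    ∃ e, Γ.src e = v ∨ Γ.tgt e = v := by
  classical
  by_contra hne
  push Not at hne
  have e₀ : E := Classical.arbitrary E
  have := hΓ.eq_of_forall_edge (y := fun x => if x = v then 1 else 0)
    (fun e => by simp [(hne e).1, (hne e).2]) v (Γ.src e₀)
  simp [(hne e₀).1] at this

/-- On a tree, increments along the edges can be prescribed arbitrarily. -/
theorem IsTree.exists_potential [Fintype V] [Fintype E] (hΓ : Γ.IsTree) (d : E → ℝ) :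
    ∃ y : V → ℝ, ∀ e, y (Γ.tgt e) - y (Γ.src e) = d e := by
  classical
  let D : (V → ℝ) →ₗ[ℝ] (E → ℝ) := LinearMap.funLeft ℝ ℝ Γ.tgt - LinearMap.funLeft ℝ ℝ Γ.src
  have hD : ∀ y e, D y e = y (Γ.tgt e) - y (Γ.src e) := fun _ _ => rfl
  -- A tree has one vertex more than edges and the kernel of the difference map consists of
  -- constants, so the map is onto by counting dimensions.
  have hcard : Fintype.card E + 1 ≤ Fintype.card V := by
    rw [← hΓ.2.2.card_edgeFinset, ← Finset.card_univ, Nat.add_le_add_iff_right]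
    refine Finset.card_le_card_of_injOn (fun e => s(Γ.src e, Γ.tgt e)) (fun e _ => ?_)
      hΓ.2.1.injOn
    rw [Finset.mem_coe, SimpleGraph.mem_edgeFinset, SimpleGraph.mem_edgeSet, toSimpleGraph,
      SimpleGraph.fromRel_adj]
    exact ⟨hΓ.1 e, Or.inl ⟨e, rfl, rfl⟩⟩
  have hker : Module.finrank ℝ (LinearMap.ker D) ≤ 1 := by
    have hle : LinearMap.ker D ≤ Submodule.span ℝ {fun _ => 1} := by
      intro y hy
      obtain ⟨v₀⟩ := hΓ.2.2.connected.nonempty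
      refine Submodule.mem_span_singleton.2 ⟨y v₀, funext fun v => ?_⟩
      have := hΓ.eq_of_forall_edge (y := y) (fun e => sub_eq_zero.1 (congrFun hy e)) v v₀
      simp [this]
    exact (Submodule.finrank_mono hle).trans
      ((finrank_span_le_card _).trans (by simp))
  have hrange : LinearMap.range D = ⊤ := by
    apply Submodule.eq_top_of_finrank_eq
    have h1 := D.finrank_range_add_finrank_ker
    have h2 := (LinearMap.range D).finrank_le
    rw [Module.finrank_fintype_fun_eq_card] at h1 h2 ⊢
    omega
  obtain ⟨y, hy⟩ := LinearMap.range_eq_top.1 hrange d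
  exact ⟨y, fun e => by rw [← hD, hy]⟩

namespace Subdivision

variable {m : ℕ} (S : Γ.Subdivision m)

/-- Subdividing a tree leaves a tree: the total increments of the edges fix the values at the
vertices, and partial sums fill in the inner nodes. -/
theorem exists_node_potential [Fintype V] [Fintype E] (hΓ : Γ.IsTree) (d : E × Fin (m + 1) → ℝ) :
    ∃ y : V ⊕ E × Fin m → ℝ, ∀ π : E × Fin (m + 1),
      y (node Γ m π.1 (π.2 + 1)) - y (node Γ m π.1 π.2) = d π := by
  let d' : E → ℕ → ℝ := fun e k => if h : k < m + 1 then d (e, ⟨k, h⟩) else 0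
  obtain ⟨y, hy⟩ := hΓ.exists_potential fun e => ∑ k ∈ Finset.range (m + 1), d' e k
  let z : V ⊕ E × Fin m → ℝ := Sum.elim y fun w =>
    y (Γ.src w.1) + ∑ k ∈ Finset.range (w.2 + 1), d' w.1 k
  have hz : ∀ e k, k ≤ m + 1 →
      z (node Γ m e k) = y (Γ.src e) + ∑ i ∈ Finset.range k, d' e i := by
    intro e k hk
    rcases k with _ | k
    · simp [node_zero, z]
    · rcases (Nat.le_of_succ_le_succ hk).eq_or_lt with rfl | h
      · rw [node_last, ← hy e]
        simp [z]
      · rw [node_succ e ⟨k, h⟩]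
        rfl
  refine ⟨z, fun π => ?_⟩
  rw [hz _ _ (by omega), hz _ _ (by omega), Finset.sum_range_succ]
  simp only [d', dif_pos π.2.2]
  ring

theorem exists_piece_ne_zero (hinc : ∀ v, ∃ e, Γ.src e = v ∨ Γ.tgt e = v)
    {c : V ⊕ E × Fin m → ℝ} (hc : c ≠ 0) : ∃ π : E × Fin (m + 1),
      ¬ (c (node Γ m π.1 π.2) = 0 ∧ c (node Γ m π.1 (π.2 + 1)) = 0) := by
  obtain ⟨x, hx⟩ := Function.ne_iff.1 hc
  rcases x with v | ⟨e, j⟩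
  · obtain ⟨e, rfl | rfl⟩ := hinc v
    · exact ⟨(e, 0), fun h => hx h.1⟩
    · exact ⟨(e, Fin.last m), fun h => hx (by simpa [node_last] using h.2)⟩
  · exact ⟨(e, j.castSucc), fun h => hx (by simpa [node_succ] using h.2)⟩

/-- There are arbitrarily fine subdivisions whose nodes avoid the zeros of a given solution. -/
theorem exists_fine [Fintype E] {q : E → ℝ → ℝ} {a : V → ℝ} {l : ℝ}
    (F : ∀ e, FundSystem (Γ.primitive q e) (Γ.len e)) {u : Γ.Point → ℝ} (hu : IsRealSol q a l u)
    (hv : ∀ v, u (Point.vertex v) ≠ 0) {ℓ : E → ℝ} (hℓ : ∀ e, 0 < ℓ e) :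
    ∃ m, ∃ S : Γ.Subdivision m, (∀ e k, k < m + 1 → S.t e (k + 1) - S.t e k ≤ ℓ e) ∧
      ∀ x, u (S.pt x) ≠ 0 := by
  obtain ⟨p, hp, -⟩ := hu
  obtain ⟨B, hB⟩ := (Set.finite_range fun e => 2 * Γ.len e / ℓ e).bddAbove
  obtain ⟨m, hm⟩ := exists_nat_ge B
  set h : E → ℝ := fun e => Γ.len e / (m + 1)
  have hm0 : (0 : ℝ) < m + 1 := by positivity
  have hh : ∀ e, 0 < h e := fun e => div_pos (Γ.len_pos e) hm0
  have hlast : ∀ e, ((m + 1 : ℕ) : ℝ) * h e = Γ.len e := fun e => by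
    simp only [h]; push_cast; field_simp
  have hfine : ∀ e, 2 * h e ≤ ℓ e := fun e => by
    have h1 : 2 * Γ.len e / ℓ e ≤ m := (hB ⟨e, rfl⟩).trans hm
    rw [div_le_iff₀ (hℓ e)] at h1
    simp only [h]
    rw [← mul_div_assoc, div_le_iff₀ hm0]
    nlinarith [hℓ e]
  -- The inner node `k` is sought in `[k * h, k * h + h / 2]`, where `u` cannot vanish identically.
  -- Consecutive nodes are then between `h / 2` and `3 * h / 2` apart.
  have hex : ∀ e (k : ℕ), ∃ x, (k = 0 → x = 0) ∧ (k = m + 1 → x = Γ.len e) ∧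
      (k : ℝ) * h e ≤ x ∧ x ≤ k * h e + h e / 2 ∧ (k ≤ m + 1 → u (onEdge e x) ≠ 0) := by
    intro e k
    have hhe := hh e
    rcases Nat.eq_zero_or_pos k with rfl | hk0
    · refine ⟨0, fun _ => rfl, fun h => by omega, by simp, by simpa using (half_pos hhe).le, fun _ => ?_⟩
      rw [onEdge_zero]
      exact hv _
    rcases lt_trichotomy k (m + 1) with hk | rfl | hk
    · by_contra hcon
      push Not at hcon
      have hk' : (k : ℝ) + 1 ≤ ((m + 1 : ℕ) : ℝ) := by exact_mod_cast hk
      have hzero := (F e).eq_zero_of_eqOn_zero (hp e) (a := k * h e) (b := k * h e + h e / 2)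
        (by positivity) (by linarith) (by nlinarith [hlast e])
        (fun x hx => (hcon x (by omega) (by omega) hx.1 hx.2).2) 0 ⟨le_rfl, (Γ.len_pos e).le⟩
      refine hv (Γ.src e) ?_
      rw [← onEdge_zero]
      exact hzero.1
    · refine ⟨Γ.len e, fun h => by omega, fun _ => rfl, (hlast e).le, by rw [hlast]; linarith,
        fun _ => ?_⟩
      rw [onEdge_len]
      exact hv _
    · exact ⟨k * h e, fun h => by omega, fun h => by omega, le_rfl, by linarith,
        fun h => by omega⟩
  choose t h0 h1 h2 h3 h4 using hex
  refine ⟨m, ⟨t, fun e => h0 e 0 rfl, fun e => h1 e _ rfl, fun e k _ => ?_⟩, fun e k _ => ?_, ?_⟩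
  · have := h3 e k
    have := h2 e (k + 1)
    push_cast at this
    linarith [hh e]
  · have := h2 e k
    have := h3 e (k + 1)
    push_cast at this
    simp only
    linarith [hh e, hfine e]
  · rintro (v | ⟨e, j⟩)
    · exact hv v
    · exact h4 e (j + 1) (by omega)

/-- The zeros of a solution which does not vanish at the nodes correspond to the pieces on which it
changes sign. -/
theorem encard_zeros [Fintype E] {q : E → ℝ → ℝ} {a : V → ℝ} {l : ℝ}
    (hr : ∀ e k, k < m + 1 →
      ∃ c D, RiccatiOn (Γ.primitive q e) l c D (S.t e k) (S.t e (k + 1)))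
    (F : ∀ e, FundSystem (Γ.primitive q e) (Γ.len e))
    {u : Γ.Point → ℝ} (hu : IsRealSol q a l u) (hne : ∀ x, u (S.pt x) ≠ 0) :
    {z : Γ.Point | u z = 0}.encard = ({π : E × Fin (m + 1) | u (S.pt (node Γ m π.1 π.2)) *
      u (S.pt (node Γ m π.1 (π.2 + 1))) < 0}.ncard : ℕ∞) := by
  classical
  obtain ⟨p, hp, -⟩ := hu
  choose _ _ hric using hr
  set N := {π : E × Fin (m + 1) | u (S.pt (node Γ m π.1 π.2)) *
      u (S.pt (node Γ m π.1 (π.2 + 1))) < 0}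
  have hb : ∀ π : E × Fin (m + 1), u (onEdge π.1 (S.t π.1 (π.2 + 1))) ≠ 0 := fun π => by
    rw [← S.pt_node π.1 (by omega)]
    exact hne _
  have hzeros : ∀ π : E × Fin (m + 1), _ := fun π =>
    FundSystem.zeros_of_riccatiOn (F π.1) (hp π.1) (S.t_mem π.1 (k := π.2) (by omega)).1
      (S.t_lt π.1 π.2 π.2.2) (S.t_mem π.1 (k := π.2 + 1) (by omega)).2
        (hric π.1 π.2 π.2.2) (hb π)
  have hN : ∀ π : E × Fin (m + 1), π ∈ N ↔
      u (onEdge π.1 (S.t π.1 π.2)) * u (onEdge π.1 (S.t π.1 (π.2 + 1))) < 0 := fun π => by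
    rw [← S.pt_node π.1 (by omega), ← S.pt_node π.1 (by omega)]
    rfl
  have hex : ∀ π, ∃ z, π ∈ N → z ∈ Set.Ioo (S.t π.1 π.2) (S.t π.1 (π.2 + 1)) ∧
      u (onEdge π.1 z) = 0 := by
    intro π
    by_cases h : π ∈ N
    · obtain ⟨z, hz⟩ := (hzeros π).1 ((hN π).1 h)
      exact ⟨z, fun _ => hz⟩
    · exact ⟨0, fun h' => absurd h' h⟩
  choose z hz using hex
  have hint : ∀ π ∈ N, z π ∈ Set.Ioo 0 (Γ.len π.1) := fun π hπ =>
    ⟨(S.t_mem π.1 (k := π.2) (by omega)).1.trans_lt (hz π hπ).1.1,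
      (hz π hπ).1.2.trans_le (S.t_mem π.1 (k := π.2 + 1) (by omega)).2⟩
  have hdisj : ∀ e (j k : Fin (m + 1)) x, x ∈ Set.Ioo (S.t e j) (S.t e (j + 1)) →
      x ∈ Set.Ioo (S.t e k) (S.t e (k + 1)) → j = k := by
    intro e j k x hj hk
    have h1 : ∀ j k : Fin (m + 1), x < S.t e (j + 1) → S.t e k < x → k ≤ j := by
      intro j k h1 h2
      by_contra h
      have := S.t_mono e (j := j + 1) (k := k) (by rw [not_le, Fin.lt_def] at h; omega) (by omega)
      linarith
    exact le_antisymm (h1 k j hk.2 hj.1) (h1 j k hj.2 hk.1)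
  have hinj : Set.InjOn (fun π : E × Fin (m + 1) => (onEdge π.1 (z π) : Γ.Point)) N := by
    rintro ⟨e, j⟩ hj ⟨e', k⟩ hk h
    simp only [onEdge_interior _ (hint _ hj), onEdge_interior _ (hint _ hk),
      Point.interior.injEq] at h
    obtain ⟨rfl, h⟩ := h
    have h1 := (hz _ hk).1
    rw [← h] at h1
    rw [hdisj e j k _ (hz _ hj).1 h1]
  have himage : (fun π : E × Fin (m + 1) => (onEdge π.1 (z π) : Γ.Point)) '' N =
      {z : Γ.Point | u z = 0} := by
    ext w
    constructor
    · rintro ⟨π, hπ, rfl⟩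
      exact (hz π hπ).2
    · intro hw
      rcases w with v | ⟨e, x, hx⟩
      · exact absurd hw (hne (Sum.inl v))
      · have hex : ∃ k, k ≤ m + 1 ∧ x < S.t e k := ⟨m + 1, le_rfl, by rw [S.t_last]; exact hx.2⟩
        obtain ⟨hk1, hk2⟩ := Nat.find_spec hex
        have hmin := fun j => Nat.find_min hex (m := j)
        generalize Nat.find hex = k at hk1 hk2 hmin
        rcases k with _ | j
        · rw [S.t_zero] at hk2
          exact absurd hk2 (not_lt.2 hx.1.le)
        have hux : u (onEdge e x) = 0 := by rw [onEdge_interior e hx]; exact hw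
        -- The zero `x` lies left of the node `j + 1` and of no earlier node; it is not itself a
        -- node, since `u` does not vanish there.
        have hjx : S.t e j < x := by
          refine lt_of_le_of_ne (not_lt.1 fun h => hmin j (Nat.lt_succ_self j)
            ⟨by omega, h⟩) fun h => hne (node Γ m e j) ?_
          rw [S.pt_node e (by omega), h, hux]
        set π : E × Fin (m + 1) := (e, ⟨j, by omega⟩)
        have hπ : π ∈ N := (hN π).2 ((hzeros π).2.1 x ⟨hjx, hk2⟩ hux)
        refine ⟨π, hπ, ?_⟩
        have : z π = x := (hzeros π).2.2 _ (hz π hπ).1 x ⟨hjx, hk2⟩ (hz π hπ).2 hux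
        simp only [this]
        exact onEdge_interior e hx
  rw [← himage, hinj.encard_image, N.toFinite.cast_ncard_eq]

/-! ### Continuity, monotonicity and positivity of the discrete form. -/

variable [Fintype V] [Fintype E] {q : E → ℝ → ℝ} {a : V → ℝ}
  {F : ∀ e, FundSystem (Γ.primitive q e) (Γ.len e)} {l l' : ℝ}

theorem form_discrete (c : V ⊕ E × Fin m → ℝ) :
    (S.discrete a F l).form c = ∑ π : E × Fin (m + 1),
      (F π.1).bform l (S.t π.1 π.2) (S.t π.1 (π.2 + 1)) (c (node Γ m π.1 π.2))
        (c (node Γ m π.1 (π.2 + 1))) + ∑ v, Γ.quasiCoeff q a v * c (Sum.inl v) ^ 2 := by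
  rw [DiscreteSchrodinger.form_apply, Fintype.sum_sum_type]
  simp [discrete, FundSystem.bform]

theorem continuousAt_form (hQ : ∀ e, Continuous (Γ.primitive q e))
    (hs : ∀ e k, k < m + 1 → (F e).s l (S.t e k) (S.t e (k + 1)) ≠ 0)
    (c : V ⊕ E × Fin m → ℝ) :
    ContinuousAt (fun z : ℝ × (V ⊕ E × Fin m → ℝ) => (S.discrete a F z.1).form z.2) (l, c) := by
  simp only [form_discrete, FundSystem.bform]
  refine ContinuousAt.add (tendsto_finsetSum _ fun π _ => ?_) (by fun_prop)
  obtain ⟨h1, h2, h3⟩ := (F π.1).continuousAt_coeff (hQ π.1) (S.t_mem π.1 (k := π.2) (by omega))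
    (S.t_mem π.1 (k := π.2 + 1) (by omega)) (hs π.1 π.2 π.2.2)
  have hf : ContinuousAt (Prod.fst : ℝ × (V ⊕ E × Fin m → ℝ) → ℝ) (l, c) := continuousAt_fst
  have k1 := ContinuousAt.comp (g := fun l => (F π.1).diagLeft l (S.t π.1 π.2) (S.t π.1 (π.2 + 1)))
    (f := Prod.fst) (x := (l, c)) h1 hf
  have k2 := ContinuousAt.comp (g := fun l => (F π.1).diagRight l (S.t π.1 π.2) (S.t π.1 (π.2 + 1)))
    (f := Prod.fst) (x := (l, c)) h2 hf
  have k3 := ContinuousAt.comp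
    (g := fun l => ((F π.1).s l (S.t π.1 π.2) (S.t π.1 (π.2 + 1)))⁻¹)
    (f := Prod.fst) (x := (l, c)) h3 hf
  have m1 : ContinuousAt (fun z : ℝ × (V ⊕ E × Fin m → ℝ) => z.2 (node Γ m π.1 π.2)) (l, c) := by
    fun_prop
  have m2 : ContinuousAt (fun z : ℝ × (V ⊕ E × Fin m → ℝ) => z.2 (node Γ m π.1 (π.2 + 1)))
      (l, c) := by
    fun_prop
  exact ((k1.mul (m1.pow 2)).add (k2.mul (m2.pow 2))).sub
    ((continuousAt_const.mul k3).mul (m1.mul m2))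

/-- The vertex terms do not depend on the parameter, and each piece decreases. It does so strictly
on a piece with a non-zero end value, which exists because every node is the end of a piece. -/
theorem form_strictAnti (hinc : ∀ v, ∃ e, Γ.src e = v ∨ Γ.tgt e = v) (hl : l < l')
    (hr : ∀ e k, k < m + 1 → ∃ c D, RiccatiOn (Γ.primitive q e) l' c D (S.t e k) (S.t e (k + 1)))
    {c : V ⊕ E × Fin m → ℝ} (hc : c ≠ 0) :
    (S.discrete a F l').form c < (S.discrete a F l).form c := by
  choose _ _ hric using hr
  rw [form_discrete, form_discrete]
  refine add_lt_add_of_lt_of_le ?_ le_rfl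
  have hpiece : ∀ π : E × Fin (m + 1), _ := fun π =>
    (F π.1).bform_strictAnti hl (S.t_mem π.1 (k := π.2) (by omega)).1 (S.t_lt π.1 π.2 π.2.2)
      (S.t_mem π.1 (k := π.2 + 1) (by omega)).2 (hric π.1 π.2 π.2.2) (c (node Γ m π.1 π.2))
      (c (node Γ m π.1 (π.2 + 1)))
  obtain ⟨π, hπ⟩ := exists_piece_ne_zero hinc hc
  exact Finset.sum_lt_sum (fun π _ => (hpiece π).1) ⟨π, Finset.mem_univ _,
    lt_of_not_ge fun h => hπ ((hpiece π).2 h)⟩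

theorem exists_form_pos (hQ : ∀ e, Continuous (Γ.primitive q e))
    (hinc : ∀ v, ∃ e, Γ.src e = v ∨ Γ.tgt e = v) :
    ∃ l₀, ∀ l ≤ l₀, (∀ e k, k < m + 1 → (F e).s l (S.t e k) (S.t e (k + 1)) ≠ 0) →
      ∀ c, c ≠ 0 → 0 < (S.discrete a F l).form c := by
  classical
  set K : ℝ := ∑ v, |Γ.quasiCoeff q a v|
  have hK : ∀ v, |Γ.quasiCoeff q a v| ≤ K := fun v =>
    Finset.single_le_sum (f := fun v => |Γ.quasiCoeff q a v|) (fun _ _ => abs_nonneg _)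
      (Finset.mem_univ v)
  have hK0 : 0 ≤ K := Finset.sum_nonneg fun _ _ => abs_nonneg _
  -- The affine function runs from `K` at the source to `-K` at the target. After telescoping, each
  -- edge contributes `K` times the squares of both its end values, enough to absorb the vertex
  -- coefficients.
  choose le hle using fun e =>
    RiccatiOn.exists_low (hQ e) (L := Γ.len e) K (-(2 * K / Γ.len e))
  obtain ⟨l₀, hl₀⟩ := (Set.finite_range le).bddBelow
  refine ⟨l₀, fun l hl hs c hc => ?_⟩
  have hr : ∀ e, RiccatiOn (Γ.primitive q e) l K (-(2 * K / Γ.len e)) 0 (Γ.len e) := fun e =>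
    (hle e).mono_param (hl.trans (hl₀ ⟨e, rfl⟩))
  have hpiece : ∀ π : E × Fin (m + 1), _ := fun π =>
    (F π.1).bform_lower (S.t_mem π.1 (k := π.2) (by omega)).1 (S.t_lt π.1 π.2 π.2.2)
      (S.t_mem π.1 (k := π.2 + 1) (by omega)).2
      ((hr π.1).mono_set (S.t_mem π.1 (k := π.2) (by omega)).1
        (S.t_mem π.1 (k := π.2 + 1) (by omega)).2) (hs π.1 π.2 π.2.2) (c (node Γ m π.1 π.2))
      (c (node Γ m π.1 (π.2 + 1)))
  obtain ⟨π, hπ⟩ := exists_piece_ne_zero hinc hc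
  have hlt := Finset.sum_lt_sum (fun π _ => (hpiece π).1) ⟨π, Finset.mem_univ _,
    lt_of_not_ge fun h => hπ ((hpiece π).2 h)⟩
  rw [form_discrete]
  have htel : ∑ π : E × Fin (m + 1), ((K + -(2 * K / Γ.len π.1) * S.t π.1 π.2) *
      c (node Γ m π.1 π.2) ^ 2 - (K + -(2 * K / Γ.len π.1) * S.t π.1 (π.2 + 1)) *
      c (node Γ m π.1 (π.2 + 1)) ^ 2) =
      ∑ e, K * (c (Sum.inl (Γ.src e)) ^ 2 + c (Sum.inl (Γ.tgt e)) ^ 2) := by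
    rw [Fintype.sum_prod_type]
    refine Finset.sum_congr rfl fun e _ => ?_
    have := Finset.sum_range_sub' (fun k => (K + -(2 * K / Γ.len e) * S.t e k) *
      c (node Γ m e k) ^ 2) (m + 1)
    rw [← Fin.sum_univ_eq_sum_range (fun k => (K + -(2 * K / Γ.len e) * S.t e k) *
      c (node Γ m e k) ^ 2 - (K + -(2 * K / Γ.len e) * S.t e (k + 1)) *
      c (node Γ m e (k + 1)) ^ 2)] at this
    rw [this, S.t_zero, S.t_last, node_zero, node_last]
    have := (Γ.len_pos e).ne'
    field_simp
    ring
  rw [htel] at hlt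
  -- Every vertex has at least one incident edge, so its square occurs at least once in the sum over
  -- edges.
  have hdeg : ∑ v, K * c (Sum.inl v) ^ 2 ≤
      ∑ e, K * (c (Sum.inl (Γ.src e)) ^ 2 + c (Sum.inl (Γ.tgt e)) ^ 2) := by
    have h1 : ∀ e, K * (c (Sum.inl (Γ.src e)) ^ 2 + c (Sum.inl (Γ.tgt e)) ^ 2) =
        ∑ v, ((if Γ.src e = v then K * c (Sum.inl v) ^ 2 else 0) +
          (if Γ.tgt e = v then K * c (Sum.inl v) ^ 2 else 0)) := by
      intro e
      rw [Finset.sum_add_distrib]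
      simp [mul_add]
    rw [Finset.sum_congr rfl fun e _ => h1 e, Finset.sum_comm]
    refine Finset.sum_le_sum fun v _ => ?_
    have hnn : 0 ≤ K * c (Sum.inl v) ^ 2 := by positivity
    obtain ⟨e, he⟩ := hinc v
    refine le_trans ?_ (Finset.single_le_sum (fun e _ => ?_) (Finset.mem_univ e))
    · rcases he with he | he
      · rw [if_pos he]
        exact le_add_of_nonneg_right (by split_ifs <;> simp [hnn])
      · rw [if_pos he]
        exact le_add_of_nonneg_left (by split_ifs <;> simp [hnn])
    · exact add_nonneg (by split_ifs <;> simp [hnn]) (by split_ifs <;> simp [hnn])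
  have hβ : 0 ≤ ∑ v, K * c (Sum.inl v) ^ 2 + ∑ v, Γ.quasiCoeff q a v * c (Sum.inl v) ^ 2 := by
    rw [← Finset.sum_add_distrib]
    refine Finset.sum_nonneg fun v _ => ?_
    rw [← add_mul]
    have := neg_abs_le (Γ.quasiCoeff q a v)
    exact mul_nonneg (by linarith [hK v]) (sq_nonneg _)
  linarith

end Subdivision

/-! ### Reduction to a real solution and the final count. -/

/-- Rotating `f` to be positive at `z₀` and taking the real part gives a non-zero real element of
the eigenspace. As this space is one-dimensional, `f` is a non-zero multiple of it. -/
theorem exists_real_of_multiplicity_one [Fintype E] {q : E → ℝ → ℝ}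
    (hq : ∀ e, MemLp (q e) 2 (volume.restrict (Set.Ioo 0 (Γ.len e)))) {a : V → ℝ} {l : ℝ}
    (hsimple : Γ.eigenvalueMultiplicity q (fun v => (a v : WithTop ℝ)) l = 1)
    {f : Γ.Point → ℂ} (hf : f ∈ Γ.eigenspace q (fun v => (a v : WithTop ℝ)) l) {z₀ : Γ.Point}
    (hz₀ : f z₀ ≠ 0) : ∃ u : Γ.Point → ℝ, IsRealSol q a l u ∧ ∀ z, f z = 0 ↔ u z = 0 := by
  set W := Γ.eigenspace q (fun v => (a v : WithTop ℝ)) l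
  have hg : (starRingEnd ℂ (f z₀)) • f ∈ W := W.smul_mem _ hf
  obtain ⟨hu, -⟩ := (mem_eigenspace_iff hq).1 hg
  obtain ⟨-, hzero⟩ := (mem_eigenspace_iff hq).1 W.zero_mem
  set u : Γ.Point → ℝ := fun z => (((starRingEnd ℂ (f z₀)) • f) z).re
  have hu₀ : u z₀ ≠ 0 := by
    have : u z₀ = Complex.normSq (f z₀) := by
      simp [u, Complex.normSq_apply]
    rw [this]
    exact (Complex.normSq_pos.2 hz₀).ne'
  have huW : (fun z => (u z : ℂ)) ∈ W := (mem_eigenspace_iff hq).2 ⟨hu, hzero⟩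
  have hrank : Module.finrank ℂ W = 1 := by
    have h1 : Module.rank ℂ W = 1 := by
      rw [eigenvalueMultiplicity] at hsimple
      simpa using hsimple
    exact Module.finrank_eq_of_rank_eq (by simpa using h1)
  have hne : (⟨_, huW⟩ : W) ≠ 0 := fun h => hu₀ (by
    have := congrFun (congrArg Subtype.val h) z₀
    simpa using this)
  obtain ⟨c, hc⟩ := (finrank_eq_one_iff_of_nonzero' _ hne).1 hrank ⟨f, hf⟩
  have hfc : ∀ z, f z = c * u z := fun z => (congrFun (congrArg Subtype.val hc) z).symm
  have hc0 : c ≠ 0 := by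
    rintro rfl
    exact hz₀ (by simp [hfc])
  refine ⟨u, hu, fun z => ?_⟩
  rw [hfc z]
  simp [hc0]

/-- The number of eigenvalues below `μ` is the number of zeros of a real solution for `μ` which does
not vanish at the vertices. -/
theorem eigenvalueCount_eq_encard_zeros [Fintype V] [Fintype E] [Nonempty E] (hΓ : Γ.IsTree)
    {q : E → ℝ → ℝ} (hq : ∀ e, MemLp (q e) 2 (volume.restrict (Set.Ioo 0 (Γ.len e))))
    {a : V → ℝ} {μ : ℝ} {u : Γ.Point → ℝ} (hu : IsRealSol q a μ u)
    (hv : ∀ v, u (Point.vertex v) ≠ 0) :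
    Γ.eigenvalueCount q (fun v => (a v : WithTop ℝ)) (Set.Iio μ) =
      {z : Γ.Point | u z = 0}.encard ∧ {z : Γ.Point | u z = 0}.encard ≠ ⊤ := by
  have hQ : ∀ e, Continuous (Γ.primitive q e) := fun e => continuous_edgePrimitive (hq e)
  have hinc := hΓ.exists_edge
  let F : ∀ e, FundSystem (Γ.primitive q e) (Γ.len e) := fun e =>
    (FundSystem.nonempty (hQ e) (Γ.len_pos e)).some
  choose ℓ hℓ hric using fun e => RiccatiOn.exists_of_short (hQ e) (Γ.len e) μ
  obtain ⟨m, S, hfine, hne⟩ := Subdivision.exists_fine F hu hv hℓ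
  have hr : ∀ l ≤ μ, ∀ e k, k < m + 1 →
      ∃ c D, RiccatiOn (Γ.primitive q e) l c D (S.t e k) (S.t e (k + 1)) := by
    intro l hl e k hk
    obtain ⟨c, D, h⟩ := hric e (S.t e k) (S.t e (k + 1)) (S.t_mem e hk.le).1 (S.t_mem e hk).2
      (hfine e k hk)
    exact ⟨c, D, h.mono_param hl⟩
  have hs : ∀ l ≤ μ, ∀ e k, k < m + 1 → 0 < (F e).s l (S.t e k) (S.t e (k + 1)) := by
    intro l hl e k hk
    obtain ⟨_, _, h⟩ := hr l hl e k hk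
    exact (F e).s_pos (S.t_mem e hk.le).1 (S.t_mem e hk).2 h le_rfl (S.t_lt e k hk) le_rfl
  have hs' : ∀ l ≤ μ, ∀ e k, k < m + 1 → (F e).s l (S.t e k) (S.t e (k + 1)) ≠ 0 :=
    fun l hl e k hk => (hs l hl e k hk).ne'
  have hflow := QuadraticForm.encard_degenerate_eq_sigNeg
    (Q := fun l => (S.discrete a F l).form) (μ := μ)
    (fun l hl c => S.continuousAt_form hQ (hs' l hl) c)
    (fun l l' h h' c hc => S.form_strictAnti hinc h (hr l' h') hc)
    (by
      obtain ⟨l₀, h⟩ := S.exists_form_pos (a := a) (F := F) hQ hinc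
      -- The pieces are known to be free of conjugate points only for parameters up to `μ`.
      exact ⟨min l₀ μ, fun l hl => h l (hl.trans (min_le_left _ _))
        (hs' l (hl.trans (min_le_right _ _)))⟩)
  have hsig := (S.discrete a F μ).sigNeg_form (fun π => inv_pos.2 (hs μ le_rfl π.1 π.2 π.2.2))
    (Subdivision.exists_node_potential hΓ) (S.op_discrete_of_isRealSol (hs' μ le_rfl) hu) hne
  have hz := S.encard_zeros (hr μ le_rfl) F hu hne
  have hcount : Γ.eigenvalueCount q (fun v => (a v : WithTop ℝ)) (Set.Iio μ) =
      {z : Γ.Point | u z = 0}.encard := by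
    rw [hz, eigenvalueCount]
    refine Eq.trans (congrArg Set.encard ?_) (hflow.trans (congrArg _ hsig))
    ext ⟨l, j⟩
    refine and_congr_right fun hl => ?_
    rw [S.eigenvalueMultiplicity_eq hq (hs' l (le_of_lt hl)), Nat.cast_lt]
  refine ⟨hcount, ?_⟩
  rw [hz]
  exact ENat.natCast_ne_top _

theorem eigenvalueCount_Iic [Fintype E] {q : E → ℝ → ℝ} {α : V → WithTop ℝ} {μ : ℝ}
    (hsimple : Γ.eigenvalueMultiplicity q α μ = 1) :
    Γ.eigenvalueCount q α (Set.Iic μ) = Γ.eigenvalueCount q α (Set.Iio μ) + 1 := by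
  rw [eigenvalueCount, eigenvalueCount, ← Set.encard_insert_of_notMem (a := (μ, 0)) (by simp)]
  congr 1
  ext ⟨l, j⟩
  simp only [Set.mem_ofPred_eq, Set.mem_Iic, Set.mem_Iio, Set.mem_insert_iff, Prod.mk.injEq]
  rcases lt_trichotomy l μ with h | rfl | h
  · simp [h, h.le, h.ne]
  · simp [hsimple]
  · simp [h.not_ge, h.not_gt, h.ne']

end MetricGraph

/-- If `k` is the number of zeros, the two conditions on the index read `k < n` and `n ≤ k + 1`. -/
theorem theorem6 {V E : Type*} [Fintype V] [Fintype E] [Nonempty E]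
    (Γ : MetricGraph V E) (hΓ : Γ.IsTree)
    (q : E → ℝ → ℝ) (hq : ∀ e, MemLp (q e) 2 (volume.restrict (Set.Ioo 0 (Γ.len e))))
    (α : V → WithTop ℝ) (n : ℕ) (μ : ℝ)
    (hn : Γ.IsNthEigenvalue q α n μ)
    (hsimple : Γ.eigenvalueMultiplicity q α μ = 1)
    (f : Γ.Point → ℂ) (hf : f ∈ Γ.eigenspace q α μ)
    (hfv : ∀ v : V, f (MetricGraph.Point.vertex v) ≠ 0) :
    {p : Γ.Point | f p = 0}.encard + 1 = n := by
  have hα : ∀ v, ∃ r : ℝ, (r : WithTop ℝ) = α v := fun v =>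
    WithTop.ne_top_iff_exists.1 fun h => hfv v ((hf.2 v).1 h)
  choose a ha using hα
  obtain rfl : (fun v => (a v : WithTop ℝ)) = α := funext ha
  obtain ⟨v₀⟩ := hΓ.2.2.connected.nonempty
  obtain ⟨u, hu, hzero⟩ := MetricGraph.exists_real_of_multiplicity_one hq hsimple hf (hfv v₀)
  obtain ⟨hcount, hfin⟩ := MetricGraph.eigenvalueCount_eq_encard_zeros hΓ hq hu
    fun v h => hfv v ((hzero _).2 h)
  simp only [hzero]
  obtain ⟨h1, h2⟩ := hn
  rw [MetricGraph.eigenvalueCount_Iic hsimple] at h2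
  rw [hcount] at h1 h2
  obtain ⟨k, hk⟩ := ENat.ne_top_iff_exists.1 hfin
  rw [← hk] at h1 h2 ⊢
  norm_cast at h1 h2 ⊢
  omega
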